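/- The hypercube $Q_n$ is the graph whose vertices are the binary strings of length $n$ (equivalently, the subsets of $\{1,\dots,n\}$), two of them being adjacent if they differ in exactly one position $i$, called the direction of the edge; $u^i$ denotes the neighbour of $u$ in direction $i$. The parity of a vertex is the parity of its number of ones. A half-layer in direction $i$ consists of all edges $ww^i$ with $w_i=0$ and $w$ of one fixed parity (even or odd). A $u$-avoiding almost half-layer in direction $i$ is a half-layer in direction $i$ containing the edge $uu^i$, with that one edge removed. A path extends a matching $M$ if it contains all edges of $M$. For a matching $M$ of $Q_n$ and vertices $u,v$ of $Q_n$ consider the conditions: - C1: $M$ contains a half-layer that covers both $u$ and $v$; - C2: there are directions $i\neq j$ such that $v=u^i$, $M$ contains a $u$-avoiding almost half-layer in direction $i$, and $uu^j, vv^j\in M$; - C3: $uv\in M$. **Theorem 1.8.** Let $n\ge d\ge 5$, let $u$ and $v$ be vertices of $Q_n$ of opposite parity, and let $M$ be a matching of $Q_n$ whose edges have at most $d$ distinct directions. Assume that the following holds in dimension $d$: for all vertices $u',v'$ of $Q_d$ of opposite parity and every matching $M'$ of $Q_d$, if none of C1, C2, C3 holds for $M',u',v'$, then there are two distinct Hamilton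 paths of $Q_d$ between $u'$ and $v'$ that extend $M'$. Then there is a Hamilton path of $Q_n$ between $u$ and $v$ that extends $M$ if and only if none of C1, C2, C3 holds for $M,u,v$. -/

import Mathlib

namespace QCube

/-- Vertices of the `n`-dimensional hypercube: binary strings of length `n`
(equivalently, subsets of `{1, …, n}`, through characteristic functions). -/
abbrev Vert (n : ℕ) : Type := Fin n → Bool

/-- The hypercube graph: two strings are adjacent iff they differ in exactly one position. -/
def graph (n : ℕ) : SimpleGraph (Vert n) where
  Adj u v := ∃! i, u i ≠ v i
  symm := ⟨fun _ _ ⟨i, hi, hu⟩ => ⟨i, hi.symm, fun j hj => hu j hj.symm⟩⟩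
  loopless := ⟨fun _ ⟨_, hi, _⟩ => hi rfl⟩

/-- The neighbour of `u` in direction `i`. -/
def nbr {n : ℕ} (u : Vert n) (i : Fin n) : Vert n := Function.update u i (!u i)

/-- The number of ones of a vertex; its parity is the parity of the vertex. -/
def ones {n : ℕ} (u : Vert n) : ℕ := (Finset.univ.filter fun i => u i = true).card

/-- The vertices `u` and `v` have opposite parity. -/
def OppositeParity {n : ℕ} (u v : Vert n) : Prop := Even (ones u) ↔ Odd (ones v)

/-- The layer in direction `i`: all edges of the hypercube in direction `i`. -/
def layer {n : ℕ} (i : Fin n) : Set (Sym2 (Vert n)) := {e | ∃ w : Vert n, e = s(w, nbr w i)}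

/-- The half-layer in direction `i` of parity `b` (`true` is even): all edges in direction `i`
of the given parity, the parity of an edge in direction `i` being that of its endpoint with
a zero in position `i`. -/
def halfLayer {n : ℕ} (i : Fin n) (b : Bool) : Set (Sym2 (Vert n)) :=
  {e | ∃ w : Vert n, w i = false ∧ (Even (ones w) ↔ b = true) ∧ e = s(w, nbr w i)}

/-- The vertex `u` is covered by the set of edges `H`. -/
def Covered {n : ℕ} (u : Vert n) (H : Set (Sym2 (Vert n))) : Prop := ∃ e ∈ H, u ∈ e

/-- `A` is a `u`-avoiding almost half-layer in direction `i`: a half-layer in direction `i`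
without its edge incident to `u`. -/
def IsAvoidingAlmostHalfLayer {n : ℕ} (u : Vert n) (i : Fin n)
    (A : Set (Sym2 (Vert n))) : Prop :=
  ∃ b : Bool, ∃ e ∈ halfLayer i b, u ∈ e ∧ A = halfLayer i b \ {e}

/-- The set of directions in which `M` has an edge. -/
def directions {n : ℕ} (M : (graph n).Subgraph) : Set (Fin n) :=
  {i | ∃ e ∈ M.edgeSet, e ∈ layer i}

/-- Condition C1: `M` contains a half-layer that covers both `u` and `v`. -/
def C1 {n : ℕ} (M : (graph n).Subgraph) (u v : Vert n) : Prop :=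
  ∃ (i : Fin n) (b : Bool), halfLayer i b ⊆ M.edgeSet ∧
    Covered u (halfLayer i b) ∧ Covered v (halfLayer i b)

/-- Condition C2: for some directions `i ≠ j`, `v` is the neighbour of `u` in direction `i`,
`M` contains a `u`-avoiding almost half-layer in direction `i`, and `M` contains the edges in
direction `j` at `u` and at `v`. -/
def C2 {n : ℕ} (M : (graph n).Subgraph) (u v : Vert n) : Prop :=
  ∃ i j : Fin n, j ≠ i ∧ v = nbr u i ∧
    (∃ A, IsAvoidingAlmostHalfLayer u i A ∧ A ⊆ M.edgeSet) ∧
    M.Adj u (nbr u j) ∧ M.Adj v (nbr v j)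

/-- Condition C3: `uv` is an edge of `M`. -/
def C3 {n : ℕ} (M : (graph n).Subgraph) (u v : Vert n) : Prop := M.Adj u v

/-- `p` is a Hamilton path (between `u` and `v`) that contains all edges of `M`. -/
def IsExtendingHamiltonPath {n : ℕ} (M : (graph n).Subgraph) {u v : Vert n}
    (p : (graph n).Walk u v) : Prop :=
  p.IsHamiltonian ∧ ∀ e ∈ M.edgeSet, e ∈ p.edges

/-- The assumption on dimension `d`: for vertices `u`, `v` of opposite parity and every matching
`M`, if none of C1, C2, C3 holds, then there are two distinct Hamilton paths between `u` and `v`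
that extend `M`. -/
def TwoHamiltonPaths (d : ℕ) : Prop :=
  ∀ (u v : Vert d) (M : (graph d).Subgraph), OppositeParity u v → M.IsMatching →
    ¬ C1 M u v → ¬ C2 M u v → ¬ C3 M u v →
    ∃ p q : (graph d).Walk u v,
      p ≠ q ∧ IsExtendingHamiltonPath M p ∧ IsExtendingHamiltonPath M q

end QCube

/-!
A half-layer in direction `k` consists of the edges in direction `k` at the vertices of one class,
where the class `cls k w` of a vertex `w` is the parity of `w` with position `k` deleted. An edge
in direction `k` stays inside its class and every other edge changes it (`cls_nbr_self`,
`cls_nbr_of_ne`). This turns C1 and C2 into `Blocked1` and `Blocked2`, statements about a matching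
relation.

Necessity. If a Hamilton path contains the half-layer on a class, or all of it but one edge, then it
visits that class in pairs `{w, nbr w k}`. Between two such visits it stays in the other class along
direction `k`, that is, inside one pair. So every pair of the other class is entered from a pair
of the first class, each of which is left at most once. The numbers of pairs are equal, but under
C1 the pair of the last vertex is never left, and under C2 the two ends of the path use up one pair
(`false_of_missed_pair`).

Sufficiency. By induction on the dimension there are even two distinct Hamilton paths
(`twoPaths_of_admissible`). As long as the dimension exceeds `d`, some direction `i` carries no edge
of the matching, and it splits the cube into two subcubes, each with its own matching
(`twoPaths_step`).

* If `u` and `v` lie in different subcubes, an edge in direction `i` joins two paths given by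
  induction. A suitable edge exists unless C1 holds (`exists_admissible`).
* If they lie in one subcube and are admissible there, a Hamilton path of this subcube is opened at
  an edge `ab` outside the matching and rerouted through the other subcube. The edge has to be
  admissible for the matching `R'` of the other subcube, which excludes only the edges of `R'` and
  those satisfying C2. It exists because induction supplies two distinct paths: if every edge of
  both were unsuitable, their symmetric difference would be balanced at every vertex and hence be
  a four-cycle with two opposite sides in `R'`, and exchanging opposite sides of it cannot lead
  from one path to the other (`exists_admissible_edge`).
* If they lie in one subcube and satisfy C1 or C2 there, the matching of this subcube has only edges
  in one direction `k`, apart from two edges at `u` and `v` under C2. Contracting direction `k`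
  leaves a smaller cube without constraints, where laceability results (`exists_isHam`,
  `exists_path_avoiding`) give disjoint paths from `u` and `v`; these lift to paths through all
  edges in direction `k` (`exists_zigzag`), and the other subcube connects their far ends.
-/

namespace QCube

variable {n : ℕ}

/-! ### Parities, directions and subcubes -/

@[simp] theorem nbr_self (u : Vert n) (i : Fin n) : nbr u i i = !u i := by simp [nbr]

theorem nbr_of_ne (u : Vert n) {i j : Fin n} (h : j ≠ i) : nbr u i j = u j := by
  simp [nbr, h]

@[simp] theorem nbr_nbr (u : Vert n) (i : Fin n) : nbr (nbr u i) i = u := by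
  simp [nbr]

theorem nbr_ne (u : Vert n) (i : Fin n) : nbr u i ≠ u := fun h => by
  have := congrFun h i
  simp at this

theorem nbr_comm (u : Vert n) (i j : Fin n) : nbr (nbr u i) j = nbr (nbr u j) i := by
  rcases eq_or_ne i j with rfl | h
  · rfl
  · simp only [nbr, Function.update_of_ne h, Function.update_of_ne h.symm]
    exact Function.update_comm h _ _ _

theorem nbr_dir_inj {u : Vert n} {i j : Fin n} (h : nbr u i = nbr u j) : i = j := by
  by_contra hij
  have := congrFun h i
  simp [nbr_of_ne u hij] at this

theorem nbr_inj {u v : Vert n} {i : Fin n} : nbr u i = nbr v i ↔ u = v :=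
  ⟨fun h => by rw [← nbr_nbr u i, h, nbr_nbr], fun h => by rw [h]⟩

theorem eq_nbr_comm {u v : Vert n} {i : Fin n} : v = nbr u i ↔ u = nbr v i :=
  ⟨fun h => by rw [h, nbr_nbr], fun h => by rw [h, nbr_nbr]⟩

theorem adj_iff {u v : Vert n} : (graph n).Adj u v ↔ ∃ i, v = nbr u i := by
  constructor
  · rintro ⟨i, hi, hu⟩
    refine ⟨i, funext fun j => ?_⟩
    rcases eq_or_ne j i with rfl | hj
    · rw [nbr_self]; revert hi; cases u j <;> cases v j <;> simp
    · rw [nbr_of_ne u hj]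
      by_contra h
      exact hj (hu j (Ne.symm h))
  · rintro ⟨i, rfl⟩
    refine ⟨i, by simp, fun j hj => ?_⟩
    by_contra h
    exact hj (nbr_of_ne u h).symm

theorem adj_nbr (u : Vert n) (i : Fin n) : (graph n).Adj u (nbr u i) := adj_iff.2 ⟨i, rfl⟩

/-- The vertex of `Q_{n+1}` with entry `b` in position `i` and the entries of `w` elsewhere; for
fixed `i` and `b` these vertices form one of the two subcubes that direction `i` splits
`Q_{n+1}` into. -/
def ins (i : Fin (n + 1)) (b : Bool) (w : Vert n) : Vert (n + 1) :=
  Fin.insertNth (α := fun _ => Bool) i b w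

@[simp] theorem ins_same (i : Fin (n + 1)) (b : Bool) (w : Vert n) : ins i b w i = b := by
  simp [ins]

@[simp] theorem ins_succAbove (i : Fin (n + 1)) (b : Bool) (w : Vert n) (j : Fin n) :
    ins i b w (i.succAbove j) = w j := by
  simp [ins]

theorem exists_ins (i : Fin (n + 1)) (u : Vert (n + 1)) : ∃ w, u = ins i (u i) w :=
  ⟨i.removeNth u, (Fin.insertNth_self_removeNth i u).symm⟩

@[simp] theorem ins_inj {i : Fin (n + 1)} {b c : Bool} {w x : Vert n} :
    ins i b w = ins i c x ↔ b = c ∧ w = x := by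
  constructor
  · intro h
    refine ⟨by simpa using congrFun h i, funext fun j => by simpa using congrFun h (i.succAbove j)⟩
  · rintro ⟨rfl, rfl⟩; rfl

theorem ins_injective (i : Fin (n + 1)) (b : Bool) : Function.Injective (ins i b) :=
  fun _ _ h => (ins_inj.1 h).2

@[simp] theorem nbr_ins_same (i : Fin (n + 1)) (b : Bool) (w : Vert n) :
    nbr (ins i b w) i = ins i (!b) w := by
  refine funext fun j => ?_
  rcases Fin.eq_self_or_eq_succAbove i j with rfl | ⟨j, rfl⟩
  · simp
  · rw [nbr_of_ne _ (Fin.succAbove_ne i j)]; simp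

@[simp] theorem nbr_ins_succAbove (i : Fin (n + 1)) (b : Bool) (w : Vert n) (j : Fin n) :
    nbr (ins i b w) (i.succAbove j) = ins i b (nbr w j) := by
  refine funext fun l => ?_
  rcases Fin.eq_self_or_eq_succAbove i l with rfl | ⟨l, rfl⟩
  · rw [nbr_of_ne _ (Fin.succAbove_ne _ j).symm]; simp
  · rcases eq_or_ne l j with rfl | h
    · simp
    · rw [nbr_of_ne _ (fun e => h (Fin.succAbove_right_injective e))]
      simp [nbr_of_ne w h]

theorem adj_ins (i : Fin (n + 1)) (b : Bool) (w : Vert n) :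
    (graph (n + 1)).Adj (ins i b w) (ins i (!b) w) := by
  rw [← nbr_ins_same]; exact adj_nbr _ _

/-- The inclusion of a subcube of codimension one, as a graph homomorphism. -/
def insHom (i : Fin (n + 1)) (b : Bool) : graph n →g graph (n + 1) where
  toFun := ins i b
  map_rel' {x y} h := by
    obtain ⟨j, rfl⟩ := adj_iff.1 h
    rw [← nbr_ins_succAbove]; exact adj_nbr _ _

theorem adj_ins_ins (i : Fin (n + 1)) (b : Bool) {w x : Vert n} (h : (graph n).Adj w x) :
    (graph (n + 1)).Adj (ins i b w) (ins i b x) :=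
  (insHom i b).map_adj h

/-- The parity of a vertex; `true` is odd. -/
def par (w : Vert n) : Bool := decide (Odd (ones w))

theorem ones_ins (i : Fin (n + 1)) (b : Bool) (w : Vert n) :
    ones (ins i b w) = b.toNat + ones w := by
  simp only [ones, Finset.card_filter]
  rw [Fin.sum_univ_succAbove _ i]
  cases b <;> simp

@[simp] theorem par_ins (i : Fin (n + 1)) (b : Bool) (w : Vert n) :
    par (ins i b w) = (b ^^ par w) := by
  simp only [par, ones_ins]
  cases b <;> simp [add_comm 1, Nat.even_add_one, ← Nat.not_even_iff_odd]

@[simp] theorem par_nbr (w : Vert n) (i : Fin n) : par (nbr w i) = !par w := by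
  cases n with
  | zero => exact i.elim0
  | succ n =>
    obtain ⟨x, hx⟩ := exists_ins i w
    rw [hx, nbr_ins_same]
    simp

theorem oppositeParity_iff {u v : Vert n} : OppositeParity u v ↔ par v = !par u := by
  simp only [OppositeParity, par, ← Nat.not_even_iff_odd]
  by_cases h : Even (ones u) <;> by_cases h' : Even (ones v) <;> simp [h, h']

/-- The parity of the vertex obtained from `w` by deleting position `k`. A half-layer in
direction `k` consists of the edges in direction `k` at the vertices with a given value of
`cls k`. -/
def cls (k : Fin n) (w : Vert n) : Bool := par w ^^ w k

@[simp] theorem cls_nbr_self (k : Fin n) (w : Vert n) : cls k (nbr w k) = cls k w := by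
  simp [cls]

theorem cls_nbr_of_ne {k j : Fin n} (h : k ≠ j) (w : Vert n) : cls k (nbr w j) = !cls k w := by
  simp [cls, nbr_of_ne w h]

@[simp] theorem cls_ins_succAbove (i : Fin (n + 1)) (b : Bool) (w : Vert n) (k : Fin n) :
    cls (i.succAbove k) (ins i b w) = (b ^^ cls k w) := by
  simp [cls]

@[simp] theorem cls_ins_same (i : Fin (n + 1)) (b : Bool) (w : Vert n) :
    cls i (ins i b w) = par w := by
  simp only [cls, par_ins, ins_same]
  cases b <;> cases par w <;> rfl

/-- A matching of `Q_n`, given by its adjacency relation. -/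
structure IsMatchingRel (R : Vert n → Vert n → Prop) : Prop where
  adj : ∀ {a b}, R a b → (graph n).Adj a b
  symm : ∀ {a b}, R a b → R b a
  unique : ∀ {a b c}, R a b → R a c → b = c

/-- `R` contains the half-layer in direction `k` formed by the vertices of class `a`. -/
def Full (R : Vert n → Vert n → Prop) (k : Fin n) (a : Bool) : Prop :=
  ∀ w, cls k w = a → R w (nbr w k)

/-- Condition C1 in terms of classes. -/
def Blocked1 (R : Vert n → Vert n → Prop) (u v : Vert n) : Prop :=
  ∃ k, cls k u = cls k v ∧ Full R k (cls k u)

/-- Condition C2 in terms of classes. -/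
def Blocked2 (R : Vert n → Vert n → Prop) (u v : Vert n) : Prop :=
  ∃ k j, j ≠ k ∧ v = nbr u k ∧ (∀ w, cls k w = cls k u → w ≠ u → w ≠ v → R w (nbr w k)) ∧
    R u (nbr u j) ∧ R v (nbr v j)

/-- The vertices have opposite parity and none of C1, C2, C3 holds. -/
structure Admissible (R : Vert n → Vert n → Prop) (u v : Vert n) : Prop where
  par_eq : par v = !par u
  not_blocked1 : ¬ Blocked1 R u v
  not_blocked2 : ¬ Blocked2 R u v
  not_rel : ¬ R u v

theorem mem_halfLayer {k : Fin n} {b : Bool} {e : Sym2 (Vert n)} :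
    e ∈ halfLayer k b ↔ ∃ w, cls k w = !b ∧ e = s(w, nbr w k) := by
  have key : ∀ w : Vert n, (Even (ones w) ↔ b = true) ↔ par w = !b := by
    intro w
    simp only [par, ← Nat.not_even_iff_odd]
    by_cases h : Even (ones w) <;> cases b <;> simp [h]
  constructor
  · rintro ⟨w, h0, h1, rfl⟩
    exact ⟨w, by simp [cls, h0, (key w).1 h1], rfl⟩
  · rintro ⟨w, h, rfl⟩
    rcases hw : w k with _ | _
    · exact ⟨w, hw, (key w).2 (by simpa [cls, hw] using h), rfl⟩
    · refine ⟨nbr w k, by simp [hw], (key _).2 ?_, by rw [nbr_nbr, Sym2.eq_swap]⟩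
      rw [par_nbr]
      simpa [cls, hw] using h

theorem covered_halfLayer {k : Fin n} {b : Bool} {u : Vert n} :
    Covered u (halfLayer k b) ↔ cls k u = !b := by
  constructor
  · rintro ⟨e, he, hu⟩
    obtain ⟨w, hw, rfl⟩ := mem_halfLayer.1 he
    rcases Sym2.mem_iff.1 hu with rfl | rfl
    · exact hw
    · simpa using hw
  · exact fun h => ⟨_, mem_halfLayer.2 ⟨u, h, rfl⟩, Sym2.mem_mk_left _ _⟩

theorem halfLayer_subset {k : Fin n} {b : Bool} {M : (graph n).Subgraph} :
    halfLayer k b ⊆ M.edgeSet ↔ Full M.Adj k (!b) := by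
  constructor
  · intro h w hw
    exact h (mem_halfLayer.2 ⟨w, hw, rfl⟩)
  · intro h e he
    obtain ⟨w, hw, rfl⟩ := mem_halfLayer.1 he
    exact h w hw

theorem C1_iff {M : (graph n).Subgraph} {u v : Vert n} : C1 M u v ↔ Blocked1 M.Adj u v := by
  simp only [C1, Blocked1, covered_halfLayer, halfLayer_subset]
  constructor
  · rintro ⟨k, b, h, hu, hv⟩
    exact ⟨k, hu.trans hv.symm, hu ▸ h⟩
  · rintro ⟨k, huv, h⟩
    exact ⟨k, !cls k u, by simpa using h, by simp, by simp [huv]⟩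

theorem C2_iff {M : (graph n).Subgraph} {u v : Vert n} : C2 M u v ↔ Blocked2 M.Adj u v := by
  constructor
  · rintro ⟨k, j, hj, hv, ⟨A, ⟨b, e, he, hue, rfl⟩, hA⟩, h1, h2⟩
    obtain ⟨x, hx, rfl⟩ := mem_halfLayer.1 he
    have hu : cls k u = !b := by
      rcases Sym2.mem_iff.1 hue with rfl | rfl
      · exact hx
      · simpa using hx
    refine ⟨k, j, hj, hv, fun w hw hwu hwv => ?_, h1, h2⟩
    refine hA ⟨mem_halfLayer.2 ⟨w, hw.trans hu, rfl⟩, fun h => ?_⟩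
    have hmem : u ∈ s(w, nbr w k) := by rw [Set.mem_singleton_iff.1 h]; exact hue
    rcases Sym2.mem_iff.1 hmem with rfl | rfl
    · exact hwu rfl
    · exact hwv (by rw [hv, nbr_nbr])
  · rintro ⟨k, j, hj, hv, h, h1, h2⟩
    refine ⟨k, j, hj, hv, ⟨_, ⟨!cls k u, s(u, nbr u k), mem_halfLayer.2 ⟨u, by simp, rfl⟩,
      Sym2.mem_mk_left _ _, rfl⟩, ?_⟩, h1, h2⟩
    rintro e ⟨he, hne⟩
    obtain ⟨w, hw, rfl⟩ := mem_halfLayer.1 he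
    refine h w (by simpa using hw) ?_ ?_
    · rintro rfl; exact hne rfl
    · rintro rfl; exact hne (by rw [hv, nbr_nbr, Sym2.eq_swap]; rfl)

theorem isMatchingRel_of_isMatching {M : (graph n).Subgraph} (hM : M.IsMatching) :
    IsMatchingRel M.Adj where
  adj h := M.adj_sub h
  symm h := h.symm
  unique h h' := (hM (M.edge_vert h)).unique h h'

/-! ### Necessity -/

section Positions

variable {V : Type*} [DecidableEq V] {G : SimpleGraph V}

theorem idxOf_start {u v : V} (p : G.Walk u v) : p.support.idxOf u = 0 := by
  cases p <;> simp

theorem idxOf_le_end {u v : V} {p : G.Walk u v} (hp : p.IsPath) {w : V} (hw : w ∈ p.support) :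
    p.support.idxOf w ≤ p.support.idxOf v := by
  induction p with
  | nil => simp_all
  | @cons a x c h q ih =>
    rw [SimpleGraph.Walk.cons_isPath_iff] at hp
    rw [SimpleGraph.Walk.support_cons, List.mem_cons] at hw
    rw [SimpleGraph.Walk.support_cons]
    rcases hw with rfl | hw
    · simp
    · have h1 : ∀ z ∈ q.support, a ≠ z := fun z hz e => hp.2 (e ▸ hz)
      rw [List.idxOf_cons_ne _ (h1 _ hw), List.idxOf_cons_ne _ (h1 _ q.end_mem_support)]
      exact Nat.succ_le_succ (ih hp.1 hw)

theorem exists_predecessor {u v : V} {p : G.Walk u v} (hp : p.IsPath) {w : V}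
    (hw : w ∈ p.support) (hwu : w ≠ u) :
    ∃ z ∈ p.support, G.Adj z w ∧ p.support.idxOf w = p.support.idxOf z + 1 := by
  induction p with
  | nil => simp_all
  | @cons a x c h q ih =>
    rw [SimpleGraph.Walk.cons_isPath_iff] at hp
    rw [SimpleGraph.Walk.support_cons, List.mem_cons] at hw
    have hw := hw.resolve_left hwu
    rcases eq_or_ne w x with rfl | hwx
    · refine ⟨a, by simp, h, ?_⟩
      rw [SimpleGraph.Walk.support_cons, List.idxOf_cons_ne _ hwu.symm, idxOf_start]
      simp
    · obtain ⟨z, hz, hzw, hi⟩ := ih hp.1 hw hwx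
      have hza : a ≠ z := fun e => hp.2 (e ▸ hz)
      refine ⟨z, by simp [hz], hzw, ?_⟩
      rw [SimpleGraph.Walk.support_cons, List.idxOf_cons_ne _ hwu.symm, List.idxOf_cons_ne _ hza, hi]

theorem idxOf_of_mem_edges {u v : V} {p : G.Walk u v} (hp : p.IsPath) {a b : V}
    (hab : s(a, b) ∈ p.edges) :
    p.support.idxOf b = p.support.idxOf a + 1 ∨ p.support.idxOf a = p.support.idxOf b + 1 := by
  induction p with
  | nil => simp_all
  | @cons c x d h q ih =>
    rw [SimpleGraph.Walk.cons_isPath_iff] at hp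
    rw [SimpleGraph.Walk.edges_cons, List.mem_cons] at hab
    rw [SimpleGraph.Walk.support_cons]
    rcases hab with hab | hab
    · have hx : List.idxOf x (c :: q.support) = 1 := by
        rw [List.idxOf_cons_ne _ h.ne, idxOf_start]
      rcases Sym2.eq_iff.1 hab with ⟨rfl, rfl⟩ | ⟨rfl, rfl⟩
      · left; rw [hx]; simp
      · right; rw [hx]; simp
    · have ha : c ≠ a := fun e => hp.2 (e ▸ q.fst_mem_support_of_mem_edges hab)
      have hb : c ≠ b := fun e => hp.2 (e ▸ q.snd_mem_support_of_mem_edges hab)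
      rw [List.idxOf_cons_ne _ ha, List.idxOf_cons_ne _ hb]
      rcases ih hp.1 hab with h | h <;> omega

end Positions

/-- The double counting behind necessity. Let `pr` send a vertex to its predecessor on a path, and
let `F` select from every pair `{w, nbr w k}` of the class `!a` a vertex entered from the class `a`.
If no two selected vertices are entered from the two ends of one pair of the class `a`, then the
pairs of the class `!a` inject into those of the class `a`; there are equally many of both, so
each pair of the class `a` must be left towards a selected vertex. -/
theorem false_of_missed_pair {k j : Fin n} (hjk : j ≠ k) {a : Bool} (pr : Vert n → Vert n)
    (hinj : ∀ w w', cls k w = !a → cls k w' = !a → pr w = pr w' → w = w')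
    (F : Vert n → Prop) (hF : ∀ w, cls k w = !a → ¬ F w → F (nbr w k))
    (hFcls : ∀ w, cls k w = !a → F w → cls k (pr w) = a)
    (H : ∀ w w', cls k w = !a → cls k w' = !a → F w → F w' → pr w' ≠ nbr (pr w) k)
    (z : Vert n) (hz : cls k z = a)
    (hzF : ∀ w, cls k w = !a → F w → pr w ≠ z ∧ pr w ≠ nbr z k) : False := by
  classical
  let f : Vert n → Vert n := fun w =>
    if cls k w = !a then (if F w then pr w else nbr (pr (nbr w k)) k) else nbr w j
  have hf1 : ∀ w, cls k w = !a → F w → f w = pr w := fun w h h' => by simp [f, h, h']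
  have hf2 : ∀ w, cls k w = !a → ¬ F w → f w = nbr (pr (nbr w k)) k :=
    fun w h h' => by simp [f, h, h']
  have hf3 : ∀ w, cls k w ≠ !a → f w = nbr w j := fun w h => if_neg h
  have hc : ∀ w, cls k w = !a → cls k (f w) = a := by
    intro w hw
    by_cases h : F w
    · rw [hf1 w hw h, hFcls w hw h]
    · rw [hf2 w hw h, cls_nbr_self, hFcls _ (by simpa using hw) (hF w hw h)]
  have hc' : ∀ w, cls k w ≠ !a → cls k (f w) = !a := by
    intro w hw
    rw [hf3 w hw, cls_nbr_of_ne hjk.symm]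
    revert hw; cases cls k w <;> cases a <;> simp
  have hk : ∀ w, cls k w = !a → cls k (nbr w k) = !a := fun w hw => by simpa using hw
  have hfinj : Function.Injective f := by
    intro w w' e
    by_cases h : cls k w = !a <;> by_cases h' : cls k w' = !a
    · by_cases g : F w <;> by_cases g' : F w'
      · rw [hf1 w h g, hf1 w' h' g'] at e
        exact hinj _ _ h h' e
      · rw [hf1 w h g, hf2 w' h' g'] at e
        exact absurd (eq_nbr_comm.1 e) (H w _ h (hk _ h') g (hF _ h' g'))
      · rw [hf2 w h g, hf1 w' h' g'] at e
        exact absurd (eq_nbr_comm.1 e.symm) (H w' _ h' (hk _ h) g' (hF _ h g))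
      · rw [hf2 w h g, hf2 w' h' g', nbr_inj] at e
        exact nbr_inj.1 (hinj _ _ (hk _ h) (hk _ h') e)
    · exact absurd ((congrArg (cls k) e).symm.trans (hc w h)) (by rw [hc' w' h']; simp)
    · exact absurd ((congrArg (cls k) e).trans (hc w' h')) (by rw [hc' w h]; simp)
    · rw [hf3 w h, hf3 w' h'] at e
      exact nbr_inj.1 e
  obtain ⟨w, hw⟩ := Finite.surjective_of_injective hfinj z
  by_cases h : cls k w = !a
  · by_cases g : F w
    · exact (hzF w h g).1 ((hf1 w h g).symm.trans hw)
    · exact (hzF _ (hk w h) (hF w h g)).2 (eq_nbr_comm.1 ((hf2 w h g).symm.trans hw).symm)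
  · have := hc' w h
    rw [hw, hz] at this
    revert this; cases a <;> simp

/-- The numbering `pos` of the vertices along a Hamilton path from `u` to `v` that contains `R`,
with the predecessor map `pr` of the path; the value `pr u` is irrelevant. -/
structure IsNumbering (R : Vert n → Vert n → Prop) (u v : Vert n) (pos : Vert n → ℕ)
    (pr : Vert n → Vert n) : Prop where
  inj : Function.Injective pos
  start : pos u = 0
  le_end : ∀ w, pos w ≤ pos v
  adj_pr : ∀ w, w ≠ u → (graph n).Adj (pr w) w
  pos_pr : ∀ w, w ≠ u → pos w = pos (pr w) + 1
  rel : ∀ a b, R a b → pos b = pos a + 1 ∨ pos a = pos b + 1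

theorem exists_isNumbering {M : (graph n).Subgraph} {u v : Vert n} {p : (graph n).Walk u v}
    (hp : IsExtendingHamiltonPath M p) : ∃ pos pr, IsNumbering M.Adj u v pos pr := by
  have hpath := hp.1.isPath
  choose! pr _ h2 h3 using fun w (hw : w ≠ u) =>
    exists_predecessor hpath (hp.1.mem_support w) hw
  exact ⟨fun w => p.support.idxOf w, pr,
    fun a b e => (List.idxOf_inj (hp.1.mem_support a)).1 e, idxOf_start p,
    fun w => idxOf_le_end hpath (hp.1.mem_support w), h2, h3,
    fun a b hab => idxOf_of_mem_edges hpath (hp.2 _ hab)⟩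

namespace IsNumbering

variable {R : Vert n → Vert n → Prop} {u v : Vert n} {pos : Vert n → ℕ} {pr : Vert n → Vert n}

theorem three_lt_pos (h : IsNumbering R u v pos pr) (hn : 3 ≤ n) : 3 < pos v := by
  by_contra! hle
  let f : Vert n → Fin 4 := fun w => ⟨pos w, by have := h.le_end w; omega⟩
  have hf : Function.Injective f := fun a b e => h.inj (by simpa [f] using e)
  have := Fintype.card_le_of_injective f hf
  simp only [Fintype.card_pi, Fintype.card_bool, Finset.prod_const, Finset.card_univ,
    Fintype.card_fin] at this
  have h8 : 2 ^ 3 ≤ 2 ^ n := Nat.pow_le_pow_right (by norm_num) hn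
  omega

theorem pr_ne_end (h : IsNumbering R u v pos pr) {w : Vert n} (hw : w ≠ u) : pr w ≠ v := by
  intro e
  have h1 := h.pos_pr w hw
  have h2 := h.le_end w
  rw [e] at h1
  omega

theorem pr_inj (h : IsNumbering R u v pos pr) {w w' : Vert n} (hw : w ≠ u) (hw' : w' ≠ u)
    (e : pr w = pr w') : w = w' :=
  h.inj (by rw [h.pos_pr w hw, h.pos_pr w' hw', e])

theorem cls_pr (h : IsNumbering R u v pos pr) {w : Vert n} (hw : w ≠ u) {k : Fin n}
    (hk : pr w ≠ nbr w k) : cls k (pr w) = !cls k w := by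
  obtain ⟨i, hi⟩ := adj_iff.1 (h.adj_pr w hw).symm
  rw [hi] at hk ⊢
  exact cls_nbr_of_ne (fun e => hk (by rw [e])) w

/-- An edge of the path in direction `k` cannot be left at both of its ends. -/
theorem pr_ne_nbr_pr (h : IsNumbering R u v pos pr) {w w' : Vert n} (hw : w ≠ u) (hw' : w' ≠ u)
    {k : Fin n} {a : Bool} (hcw : cls k w = !a) (hcw' : cls k w' = !a) (hpr : cls k (pr w) = a)
    (hR : R (pr w) (nbr (pr w) k)) : pr w' ≠ nbr (pr w) k := by
  intro e
  have h1 := h.pos_pr w hw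
  have h2 := h.pos_pr w' hw'
  rcases h.rel _ _ hR with h3 | h3
  · have h4 : w = nbr (pr w) k := h.inj (by omega)
    rw [h4, cls_nbr_self, hpr] at hcw
    revert hcw; cases a <;> simp
  · rw [← e] at h3
    have h4 : w' = pr w := h.inj (by omega)
    rw [h4, hpr] at hcw'
    revert hcw'; cases a <;> simp

theorem not_blocked1 (h : IsNumbering R u v pos pr) (hn : 2 ≤ n) : ¬ Blocked1 R u v := by
  rintro ⟨k, huv, hfull⟩
  have : Nontrivial (Fin n) := Fin.nontrivial_iff_two_le.2 hn
  obtain ⟨j, hjk⟩ := exists_ne k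
  have hu : ∀ w, cls k w = !cls k u → w ≠ u := by
    rintro w hw rfl
    revert hw; cases cls k w <;> simp
  have hlt : ∀ w, w ≠ u → pos w < pos (nbr w k) → pr w ≠ nbr w k := by
    intro w hw hlt e
    have := h.pos_pr w hw
    rw [e] at this
    omega
  have hFcls : ∀ w, cls k w = !cls k u → pos w < pos (nbr w k) → cls k (pr w) = cls k u := by
    intro w hw hF
    rw [h.cls_pr (hu w hw) (hlt w (hu w hw) hF), hw, Bool.not_not]
  refine false_of_missed_pair hjk pr (a := cls k u)
    (fun w w' hw hw' => h.pr_inj (hu w hw) (hu w' hw')) (fun w => pos w < pos (nbr w k))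
    ?_ hFcls ?_ v huv.symm ?_
  · intro w hw hF
    rw [nbr_nbr]
    rcases lt_or_eq_of_le (not_lt.1 hF) with h1 | h1
    · exact h1
    · exact absurd (h.inj h1) (nbr_ne w k)
  · intro w w' hw hw' hF hF'
    exact h.pr_ne_nbr_pr (hu w hw) (hu w' hw') hw hw' (hFcls w hw hF) (hfull _ (hFcls w hw hF))
  · intro w hw hF
    refine ⟨h.pr_ne_end (hu w hw), fun e => ?_⟩
    have h1 := h.pos_pr w (hu w hw)
    have h2 := h.le_end (nbr v k)
    rcases h.rel _ _ (hfull v huv.symm) with h3 | h3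
    · omega
    · have : w = v := h.inj (by rw [h1, e, h3])
      rw [this, ← huv] at hw
      revert hw; cases cls k u <;> simp

theorem not_blocked2 (h : IsNumbering R u v pos pr) (hn : 3 ≤ n) : ¬ Blocked2 R u v := by
  rintro ⟨k, j, hjk, hv, halmost, hus, hvt⟩
  have hlong := h.three_lt_pos hn
  have hu : ∀ w, cls k w = !cls k u → w ≠ u := by
    rintro w hw rfl
    revert hw; cases cls k w <;> simp
  set s := nbr u j with hs
  set t := nbr v j with ht
  have hst : t = nbr s k := by rw [ht, hv, hs, nbr_comm]
  have hpos_s : pos s = 1 := by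
    have := h.rel _ _ hus
    rw [h.start] at this
    omega
  have hpos_t : pos v = pos t + 1 := by
    have := h.le_end t
    rcases h.rel _ _ hvt with h1 | h1 <;> omega
  -- Both ends of the path enter the class of `s` through the pair `{s, t}`; of the two entries the
  -- one at `t` is selected, so that the pair `{u, v}` is missed.
  let F : Vert n → Prop := fun w => w = t ∨ (w ≠ s ∧ pos w < pos (nbr w k))
  have hFs : ¬ F s := by
    rintro (e | e)
    · rw [hst] at e
      exact nbr_ne s k e.symm
    · exact e.1 rfl
  have hFcls : ∀ w, cls k w = !cls k u → F w → cls k (pr w) = cls k u := by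
    intro w hw hF
    rw [h.cls_pr (hu w hw) ?_, hw, Bool.not_not]
    intro e
    have h1 := h.pos_pr w (hu w hw)
    rw [e] at h1
    rcases hF with rfl | hF
    · have h2 : nbr t k = s := by rw [hst, nbr_nbr]
      rw [h2] at h1
      omega
    · omega
  have hpru : ∀ w, cls k w = !cls k u → F w → pr w ≠ u := by
    intro w hw hF e
    have h1 := h.pos_pr w (hu w hw)
    rw [e, h.start, zero_add, ← hpos_s] at h1
    rw [h.inj h1] at hF
    exact hFs hF
  refine false_of_missed_pair hjk pr (a := cls k u)
    (fun w w' hw hw' => h.pr_inj (hu w hw) (hu w' hw')) F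
    ?_ hFcls ?_ u rfl ?_
  · intro w hw hF
    by_cases hws : w = s
    · exact Or.inl (by rw [hws, hst])
    · right
      have hF' : ¬ (pos w < pos (nbr w k)) := fun e => hF (Or.inr ⟨hws, e⟩)
      refine ⟨fun e => hF (Or.inl ?_), ?_⟩
      · rw [hst, ← e, nbr_nbr]
      · rw [nbr_nbr]
        rcases lt_or_eq_of_le (not_lt.1 hF') with h1 | h1
        · exact h1
        · exact absurd (h.inj h1) (nbr_ne w k)
  · intro w w' hw hw' hF hF'
    exact h.pr_ne_nbr_pr (hu w hw) (hu w' hw') hw hw' (hFcls w hw hF)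
      (halmost _ (hFcls w hw hF) (hpru w hw hF) (h.pr_ne_end (hu w hw)))
  · intro w hw hF
    exact ⟨hpru w hw hF, hv ▸ h.pr_ne_end (hu w hw)⟩

theorem not_rel (h : IsNumbering R u v pos pr) (hn : 3 ≤ n) : ¬ R u v := by
  intro hR
  have := h.three_lt_pos hn
  have h0 := h.start
  rcases h.rel _ _ hR with h1 | h1 <;> omega

end IsNumbering

/-! ### Hamilton paths and pairs of disjoint paths -/

/-- `p` is a Hamilton path containing all edges of the relation `R`. -/
structure IsHam (R : Vert n → Vert n → Prop) {u v : Vert n} (p : (graph n).Walk u v) : Prop where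
  nodup : p.support.Nodup
  mem : ∀ w, w ∈ p.support
  rel : ∀ {a b}, R a b → s(a, b) ∈ p.edges

/-- `p` and `q` are disjoint paths that together visit all vertices and contain all edges of the
relation `R`. -/
structure IsCover (R : Vert n → Vert n → Prop) {u c v d : Vert n} (p : (graph n).Walk u c)
    (q : (graph n).Walk v d) : Prop where
  nodup : (p.support ++ q.support).Nodup
  mem : ∀ w, w ∈ p.support ++ q.support
  rel : ∀ {a b}, R a b → s(a, b) ∈ p.edges ++ q.edges

/-- Two distinct Hamilton paths from `u` to `v` contain `R`. -/
def TwoPaths (R : Vert n → Vert n → Prop) (u v : Vert n) : Prop :=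
  ∃ p q : (graph n).Walk u v, p ≠ q ∧ IsHam R p ∧ IsHam R q

/-- The part of `R` inside one of the two subcubes given by direction `i`. -/
def restr (R : Vert (n + 1) → Vert (n + 1) → Prop) (i : Fin (n + 1)) (b : Bool) :
    Vert n → Vert n → Prop := fun x y => R (ins i b x) (ins i b y)

theorem IsMatchingRel.dir_inj {R : Vert n → Vert n → Prop} (hR : IsMatchingRel R) {u : Vert n}
    {i j : Fin n} (h : R u (nbr u i)) (h' : R u (nbr u j)) : i = j :=
  nbr_dir_inj (hR.unique h h')

theorem IsMatchingRel.exists_restr {R : Vert (n + 1) → Vert (n + 1) → Prop}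
    (hR : IsMatchingRel R) {i : Fin (n + 1)} (hi : ∀ w, ¬ R w (nbr w i)) {x y : Vert (n + 1)}
    (h : R x y) : ∃ b x' y', x = ins i b x' ∧ y = ins i b y' ∧ restr R i b x' y' := by
  obtain ⟨j, rfl⟩ := adj_iff.1 (hR.adj h)
  obtain ⟨x', hx⟩ := exists_ins i x
  rcases Fin.eq_self_or_eq_succAbove i j with rfl | ⟨j, rfl⟩
  · exact absurd h (hi x)
  · have hy : nbr x (i.succAbove j) = ins i (x i) (nbr x' j) := by
      rw [← nbr_ins_succAbove, ← hx]
    refine ⟨x i, x', nbr x' j, hx, hy, ?_⟩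
    rw [restr, ← hy, ← hx]
    exact h

theorem IsMatchingRel.restr {R : Vert (n + 1) → Vert (n + 1) → Prop} (hR : IsMatchingRel R)
    (i : Fin (n + 1)) (b : Bool) : IsMatchingRel (restr R i b) where
  adj {x y} h := by
    obtain ⟨j, hj⟩ := adj_iff.1 (hR.adj h)
    rcases Fin.eq_self_or_eq_succAbove i j with rfl | ⟨j, rfl⟩
    · simp at hj
    · rw [nbr_ins_succAbove, ins_inj] at hj
      exact adj_iff.2 ⟨j, hj.2⟩
  symm h := hR.symm h
  unique h h' := ins_injective i b (hR.unique h h')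

/-- The copy of a walk in one of the two subcubes given by direction `i`. -/
def lift (i : Fin (n + 1)) (b : Bool) {u v : Vert n} (p : (graph n).Walk u v) :
    (graph (n + 1)).Walk (ins i b u) (ins i b v) := p.map (insHom i b)

@[simp] theorem support_lift (i : Fin (n + 1)) (b : Bool) {u v : Vert n} (p : (graph n).Walk u v) :
    (lift i b p).support = p.support.map (ins i b) :=
  SimpleGraph.Walk.support_map _ _

theorem edge_mem_lift {i : Fin (n + 1)} {b : Bool} {u v x y : Vert n} {p : (graph n).Walk u v}
    (h : s(x, y) ∈ p.edges) : s(ins i b x, ins i b y) ∈ (lift i b p).edges := by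
  have : (lift i b p).edges = p.edges.map (Sym2.map (ins i b)) :=
    SimpleGraph.Walk.edges_map (insHom i b) p
  rw [this]
  exact List.mem_map.2 ⟨_, h, rfl⟩

/-- Two paths with the same last vertex in the two subcubes given by direction `i`, joined by an
edge in direction `i`. -/
def join (i : Fin (n + 1)) (b : Bool) {u v x : Vert n} (p : (graph n).Walk u x)
    (q : (graph n).Walk v x) : (graph (n + 1)).Walk (ins i b u) (ins i (!b) v) :=
  (lift i b p).append (.cons (adj_ins i b x) (lift i (!b) q).reverse)

theorem support_join (i : Fin (n + 1)) (b : Bool) {u v x : Vert n} (p : (graph n).Walk u x)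
    (q : (graph n).Walk v x) : (join i b p q).support =
      p.support.map (ins i b) ++ (q.support.map (ins i (!b))).reverse := by
  rw [join, SimpleGraph.Walk.support_append, SimpleGraph.Walk.support_cons,
    SimpleGraph.Walk.support_reverse, support_lift, support_lift, List.tail_cons]

theorem edges_join (i : Fin (n + 1)) (b : Bool) {u v x : Vert n} (p : (graph n).Walk u x)
    (q : (graph n).Walk v x) : (join i b p q).edges =
      (lift i b p).edges ++
        s(ins i b x, ins i (!b) x) :: (lift i (!b) q).edges.reverse := by
  rw [join, SimpleGraph.Walk.edges_append, SimpleGraph.Walk.edges_cons,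
    SimpleGraph.Walk.edges_reverse]

theorem IsHam.join {R : Vert (n + 1) → Vert (n + 1) → Prop} (hR : IsMatchingRel R)
    {i : Fin (n + 1)} (hi : ∀ w, ¬ R w (nbr w i)) {b : Bool} {u v x : Vert n}
    {p : (graph n).Walk u x} {q : (graph n).Walk v x} (hp : IsHam (restr R i b) p)
    (hq : IsHam (restr R i (!b)) q) : IsHam R (join i b p q) where
  nodup := by
    rw [support_join, List.nodup_append]
    refine ⟨hp.nodup.map (ins_injective i b),
      List.nodup_reverse.2 (hq.nodup.map (ins_injective i _)), ?_⟩
    intro y hy z hz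
    rw [List.mem_reverse] at hz
    obtain ⟨y, -, rfl⟩ := List.mem_map.1 hy
    obtain ⟨z, -, rfl⟩ := List.mem_map.1 hz
    simp
  mem w := by
    obtain ⟨w', hw⟩ := exists_ins i w
    rw [support_join, List.mem_append, List.mem_reverse, hw]
    rcases eq_or_ne (w i) b with h | h
    · left; rw [h]; exact List.mem_map.2 ⟨_, hp.mem w', rfl⟩
    · right; rw [Bool.eq_not_of_ne h]; exact List.mem_map.2 ⟨_, hq.mem w', rfl⟩
  rel {x y} h := by
    obtain ⟨c, x', y', rfl, rfl, h'⟩ := hR.exists_restr hi h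
    rw [edges_join, List.mem_append, List.mem_cons, List.mem_reverse]
    rcases eq_or_ne c b with rfl | hc
    · exact Or.inl (edge_mem_lift (hp.rel h'))
    · rw [Bool.eq_not_of_ne hc] at h' ⊢
      exact Or.inr (Or.inr (edge_mem_lift (hq.rel h')))

theorem TwoPaths.join {R : Vert (n + 1) → Vert (n + 1) → Prop} (hR : IsMatchingRel R)
    {i : Fin (n + 1)} (hi : ∀ w, ¬ R w (nbr w i)) {b : Bool} {u v x : Vert n}
    (hu : TwoPaths (restr R i b) u x) (hv : TwoPaths (restr R i (!b)) v x) :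
    TwoPaths R (ins i b u) (ins i (!b) v) := by
  obtain ⟨p, p', hne, hp, hp'⟩ := hu
  obtain ⟨q, -, -, hq, -⟩ := hv
  refine ⟨_, _, fun e => hne ?_, hp.join hR hi hq, hp'.join hR hi hq⟩
  have e := congrArg SimpleGraph.Walk.support e
  rw [support_join, support_join] at e
  exact SimpleGraph.Walk.ext_support
    ((List.map_injective_iff.2 (ins_injective i b)) (List.append_cancel_right e))

/-- Two paths in one of the subcubes given by direction `i`, joined through a path in the other
subcube. -/
def detour (i : Fin (n + 1)) (b : Bool) {u v c d : Vert n} (p : (graph n).Walk u c)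
    (r : (graph n).Walk c d) (q : (graph n).Walk v d) :
    (graph (n + 1)).Walk (ins i b u) (ins i b v) :=
  (lift i b p).append (.cons (adj_ins i b c) ((lift i (!b) r).append
    (.cons (adj_ins i b d).symm (lift i b q).reverse)))

theorem support_detour (i : Fin (n + 1)) (b : Bool) {u v c d : Vert n} (p : (graph n).Walk u c)
    (r : (graph n).Walk c d) (q : (graph n).Walk v d) : (detour i b p r q).support =
      p.support.map (ins i b) ++ (r.support.map (ins i (!b)) ++
        (q.support.map (ins i b)).reverse) := by
  rw [detour, SimpleGraph.Walk.support_append, SimpleGraph.Walk.support_cons,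
    SimpleGraph.Walk.support_append, SimpleGraph.Walk.support_cons,
    SimpleGraph.Walk.support_reverse, support_lift, support_lift,
    support_lift, List.tail_cons, List.tail_cons]

theorem edges_detour (i : Fin (n + 1)) (b : Bool) {u v c d : Vert n} (p : (graph n).Walk u c)
    (r : (graph n).Walk c d) (q : (graph n).Walk v d) : (detour i b p r q).edges =
      (lift i b p).edges ++ s(ins i b c, ins i (!b) c) :: ((lift i (!b) r).edges ++
        s(ins i (!b) d, ins i b d) :: (lift i b q).edges.reverse) := by
  rw [detour, SimpleGraph.Walk.edges_append, SimpleGraph.Walk.edges_cons,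
    SimpleGraph.Walk.edges_append, SimpleGraph.Walk.edges_cons,
    SimpleGraph.Walk.edges_reverse]

theorem IsCover.detour {R : Vert (n + 1) → Vert (n + 1) → Prop} (hR : IsMatchingRel R)
    {i : Fin (n + 1)} (hi : ∀ w, ¬ R w (nbr w i)) {b : Bool} {u v c d : Vert n}
    {p : (graph n).Walk u c} {r : (graph n).Walk c d} {q : (graph n).Walk v d}
    (hpq : IsCover (restr R i b) p q) (hr : IsHam (restr R i (!b)) r) :
    IsHam R (detour i b p r q) where
  nodup := by
    obtain ⟨hp, hq, hdisj⟩ := List.nodup_append.1 hpq.nodup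
    rw [support_detour, List.nodup_append, List.nodup_append]
    refine ⟨hp.map (ins_injective i b), ⟨hr.nodup.map (ins_injective i _),
      List.nodup_reverse.2 (hq.map (ins_injective i b)), ?_⟩, ?_⟩
    · intro y hy z hz
      rw [List.mem_reverse] at hz
      obtain ⟨y, -, rfl⟩ := List.mem_map.1 hy
      obtain ⟨z, -, rfl⟩ := List.mem_map.1 hz
      simp
    · intro y hy z hz
      rw [List.mem_append, List.mem_reverse] at hz
      obtain ⟨y, hy', rfl⟩ := List.mem_map.1 hy
      rcases hz with hz | hz
      · obtain ⟨z, -, rfl⟩ := List.mem_map.1 hz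
        simp
      · obtain ⟨z, hz', rfl⟩ := List.mem_map.1 hz
        simpa using hdisj y hy' z hz'
  mem w := by
    obtain ⟨w', hw⟩ := exists_ins i w
    rw [support_detour, List.mem_append, List.mem_append, List.mem_reverse, hw]
    rcases eq_or_ne (w i) b with h | h
    · rw [h]
      rcases List.mem_append.1 (hpq.mem w') with h' | h'
      · exact Or.inl (List.mem_map.2 ⟨_, h', rfl⟩)
      · exact Or.inr (Or.inr (List.mem_map.2 ⟨_, h', rfl⟩))
    · rw [Bool.eq_not_of_ne h]; exact Or.inr (Or.inl (List.mem_map.2 ⟨_, hr.mem w', rfl⟩))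
  rel {x y} h := by
    obtain ⟨c, x', y', rfl, rfl, h'⟩ := hR.exists_restr hi h
    rw [edges_detour, List.mem_append, List.mem_cons, List.mem_append, List.mem_cons,
      List.mem_reverse]
    rcases eq_or_ne c b with rfl | hc
    · rcases List.mem_append.1 (hpq.rel h') with h' | h'
      · exact Or.inl (edge_mem_lift h')
      · exact Or.inr (Or.inr (Or.inr (Or.inr (edge_mem_lift h'))))
    · rw [Bool.eq_not_of_ne hc] at h' ⊢
      exact Or.inr (Or.inr (Or.inl (edge_mem_lift (hr.rel h'))))

theorem TwoPaths.detour {R : Vert (n + 1) → Vert (n + 1) → Prop} (hR : IsMatchingRel R)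
    {i : Fin (n + 1)} (hi : ∀ w, ¬ R w (nbr w i)) {b : Bool} {u v c d : Vert n}
    {p : (graph n).Walk u c} {q : (graph n).Walk v d}
    (hpq : IsCover (restr R i b) p q) (h : TwoPaths (restr R i (!b)) c d) :
    TwoPaths R (ins i b u) (ins i b v) := by
  obtain ⟨r, r', hne, hr, hr'⟩ := h
  refine ⟨_, _, fun e => hne ?_, hpq.detour hR hi hr, hpq.detour hR hi hr'⟩
  have e := congrArg SimpleGraph.Walk.support e
  rw [support_detour, support_detour] at e
  exact SimpleGraph.Walk.ext_support ((List.map_injective_iff.2 (ins_injective i _))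
    (List.append_cancel_right (List.append_cancel_left e)))

/-! ### Laceability of the hypercube -/

theorem isMatchingRel_false : IsMatchingRel (fun _ _ : Vert n => False) where
  adj h := h.elim
  symm h := h.elim
  unique h := h.elim

theorem exists_ne_of_ne {u v : Vert n} (h : u ≠ v) : ∃ i, v i = !u i := by
  obtain ⟨i, hi⟩ := Function.ne_iff.1 h
  exact ⟨i, Bool.eq_not_of_ne hi.symm⟩

theorem exists_ins_ne {i : Fin (n + 1)} {u v : Vert (n + 1)} (h : v i = !u i) :
    ∃ b u' v', u = ins i b u' ∧ v = ins i (!b) v' := by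
  obtain ⟨u', hu⟩ := exists_ins i u
  obtain ⟨v', hv⟩ := exists_ins i v
  exact ⟨u i, u', v', hu, by rw [← h]; exact hv⟩

/-- Hamilton laceability of the hypercube. -/
theorem exists_isHam {u v : Vert n} (h : par v = !par u) :
    ∃ p : (graph n).Walk u v, IsHam (fun _ _ => False) p := by
  induction n with
  | zero =>
    rw [Subsingleton.elim v u] at h
    simp at h
  | succ n ih =>
    obtain ⟨i, hi⟩ := exists_ne_of_ne (u := u) (v := v) (by rintro rfl; simp at h)
    obtain ⟨b, u, v, rfl, rfl⟩ := exists_ins_ne hi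
    have huv : par v = par u := by simpa using h
    have hF := isMatchingRel_false (n := n + 1)
    cases n with
    | zero =>
      rw [Subsingleton.elim v u]
      have hnil : IsHam (fun _ _ => False) (SimpleGraph.Walk.nil : (graph 0).Walk u u) :=
        ⟨by simp, fun w => by simp [Subsingleton.elim w u], fun h => h.elim⟩
      exact ⟨_, IsHam.join hF (fun _ h => h) hnil hnil⟩
    | succ n =>
      obtain ⟨p, hp⟩ := ih (u := u) (v := nbr u 0) (par_nbr u 0)
      obtain ⟨q, hq⟩ := ih (u := v) (v := nbr u 0) (by rw [par_nbr, huv])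
      exact ⟨_, IsHam.join hF (fun _ h => h) hp hq⟩

/-- Hyper-Hamilton laceability of the hypercube: it stays traceable between any two vertices of one
parity after the deletion of a vertex `z` of the other parity. -/
theorem exists_path_avoiding {x y z : Vert n} (hxy : x ≠ y) (hx : par x = !par z)
    (hy : par y = !par z) :
    ∃ p : (graph n).Walk x y, p.support.Nodup ∧ ∀ w, w ∈ p.support ↔ w ≠ z := by
  induction n with
  | zero => exact absurd (Subsingleton.elim x y) hxy
  | succ n ih =>
    have aux : ∀ (i : Fin (n + 1)) (x y z : Vert (n + 1)), y i = !x i → z i = x i →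
        par x = !par z → par y = !par z →
        ∃ p : (graph (n + 1)).Walk x y, p.support.Nodup ∧ ∀ w, w ∈ p.support ↔ w ≠ z := by
      intro i x y z hi hz hx hy
      obtain ⟨b, x, y, rfl, rfl⟩ := exists_ins_ne hi
      obtain ⟨z', hz'⟩ := exists_ins i z
      rw [hz, ins_same] at hz'
      subst hz'
      rename' z' => z
      have hxz : par x = !par z := by
        rw [par_ins, par_ins] at hx
        revert hx; cases par x <;> cases par z <;> cases b <;> simp
      have hyz : par y = par z := by
        rw [par_ins, par_ins] at hy
        revert hy; cases par y <;> cases par z <;> cases b <;> simp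
      obtain ⟨x', p, hx', hp, hpz⟩ : ∃ (x' : Vert n) (p : (graph n).Walk x x'),
          par x' = !par z ∧ p.support.Nodup ∧ ∀ w, w ∈ p.support ↔ w ≠ z := by
        match n with
        | 0 =>
          rw [Subsingleton.elim x z] at hxz
          simp at hxz
        | 1 =>
          refine ⟨x, .nil, hxz, by simp, fun w => ?_⟩
          have hzx : z = nbr x 0 := by
            by_contra hne
            have : z = x := funext fun j => by
              rw [Subsingleton.elim j 0]
              by_contra h0
              refine hne (funext fun j => ?_)
              rw [Subsingleton.elim j 0, nbr_self]
              exact Bool.eq_not_of_ne h0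
            rw [this] at hxz
            simp at hxz
          rw [SimpleGraph.Walk.support_nil, List.mem_singleton, hzx]
          constructor
          · rintro rfl; exact (nbr_ne w 0).symm
          · intro h
            refine funext fun j => ?_
            rw [Subsingleton.elim j 0]
            by_contra h0
            refine h (funext fun j => ?_)
            rw [Subsingleton.elim j 0, nbr_self]
            exact Bool.eq_not_of_ne h0
        | n + 2 =>
          have hne : x ≠ nbr (nbr x 0) 1 := by
            intro e
            have := congrFun e 0
            rw [nbr_of_ne _ (by simp), nbr_self] at this
            simp at this
          have hpar : par (nbr (nbr x 0) 1) = !par z := by rw [par_nbr, par_nbr, hxz, Bool.not_not]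
          obtain ⟨p, hp⟩ := ih hne hxz hpar
          exact ⟨_, p, hpar, hp⟩
      obtain ⟨q, hq⟩ := exists_isHam (u := y) (v := x') (by rw [hx', hyz])
      refine ⟨join i b p q, ?_, fun w => ?_⟩
      · rw [support_join, List.nodup_append]
        refine ⟨hp.map (ins_injective i b),
          List.nodup_reverse.2 (hq.nodup.map (ins_injective i _)), ?_⟩
        intro y hy z hz
        rw [List.mem_reverse] at hz
        obtain ⟨y, -, rfl⟩ := List.mem_map.1 hy
        obtain ⟨z, -, rfl⟩ := List.mem_map.1 hz
        simp
      · obtain ⟨w', hw⟩ := exists_ins i w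
        rw [support_join, hw]
        rcases eq_or_ne (w i) b with h | h
        · rw [h]
          simp [hpz]
        · rw [Bool.eq_not_of_ne h]
          simp [hq.mem]
    obtain ⟨i, hi⟩ := exists_ne_of_ne hxy
    rcases eq_or_ne (z i) (x i) with hz | hz
    · exact aux i x y z hi hz hx hy
    · obtain ⟨p, hp, hpz⟩ := aux i y x z (by rw [hi, Bool.not_not])
        (by rw [hi]; exact Bool.eq_not_of_ne hz) hy hx
      exact ⟨p.reverse, by simpa using hp, fun w => by simpa using hpz w⟩

theorem exists_par_coord (hn : 2 ≤ n) (l : Fin n) (a b : Bool) :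
    ∃ w : Vert n, par w = a ∧ w l = b := by
  have : Nontrivial (Fin n) := Fin.nontrivial_iff_two_le.2 hn
  obtain ⟨j, hj⟩ := exists_ne l
  by_cases h : par (fun _ : Fin n => b) = a
  · exact ⟨_, h, rfl⟩
  · refine ⟨nbr (fun _ => b) j, ?_, nbr_of_ne _ hj.symm⟩
    rw [par_nbr, Bool.eq_not_of_ne h, Bool.not_not]

/-- Two vertices of one parity start disjoint paths that partition the hypercube and whose other
ends agree in a prescribed position. -/
theorem exists_isCover_same_coord (hn : 2 ≤ n) {u v : Vert (n + 1)} (huv : u ≠ v)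
    (hpar : par u = par v) (l : Fin (n + 1)) :
    ∃ (c d : Vert (n + 1)) (p : (graph (n + 1)).Walk u c) (q : (graph (n + 1)).Walk v d),
      par c = !par u ∧ par d = !par u ∧ c ≠ d ∧ c l = d l ∧ IsCover (fun _ _ => False) p q := by
  obtain ⟨j, hjl, hj⟩ : ∃ j, j ≠ l ∧ v j = !u j := by
    by_contra! h
    obtain ⟨i, hi⟩ := exists_ne_of_ne huv
    have hil : i = l := by
      by_contra hil
      exact h i hil hi
    subst hil
    have : v = nbr u i := by
      refine funext fun j => ?_
      rcases eq_or_ne j i with rfl | hj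
      · rw [nbr_self, hi]
      · rw [nbr_of_ne u hj]
        have := h j hj
        revert this; cases u j <;> cases v j <;> simp
    rw [this, par_nbr] at hpar
    simp at hpar
  obtain ⟨b, u, v, rfl, rfl⟩ := exists_ins_ne hj
  obtain ⟨l, rfl⟩ := Fin.exists_succAbove_eq hjl.symm
  obtain ⟨c, hc, hcl⟩ := exists_par_coord hn l (!par u) false
  obtain ⟨d, hd, hdl⟩ := exists_par_coord hn l (!par v) false
  obtain ⟨p, hp⟩ := exists_isHam hc
  obtain ⟨q, hq⟩ := exists_isHam hd
  refine ⟨ins j b c, ins j (!b) d, lift j b p, lift j (!b) q, ?_, ?_, ?_, ?_,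
    ?_, ?_, fun h => h.elim⟩
  · simp [hc]
  · rw [hpar]; simp [hd]
  · simp
  · simp [hcl, hdl]
  · rw [support_lift, support_lift, List.nodup_append]
    refine ⟨hp.nodup.map (ins_injective j b), hq.nodup.map (ins_injective j _), ?_⟩
    intro y hy z hz
    obtain ⟨y, -, rfl⟩ := List.mem_map.1 hy
    obtain ⟨z, -, rfl⟩ := List.mem_map.1 hz
    simp
  · intro w
    obtain ⟨w', hw⟩ := exists_ins j w
    rw [support_lift, support_lift, hw]
    rcases eq_or_ne (w j) b with h | h
    · rw [h]; simp [hp.mem]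
    · rw [Bool.eq_not_of_ne h]; simp [hq.mem]

/-- A walk in `Q_n` lifts to a walk in `Q_{n+1}` that traverses, at every vertex visited below, the
edge in direction `k` above it. -/
theorem exists_zigzag (k : Fin (n + 1)) {x y : Vert n} (p : (graph n).Walk x y) (b e : Bool)
    (he : e = !(b ^^ (par x ^^ par y))) :
    ∃ q : (graph (n + 1)).Walk (ins k b x) (ins k e y),
      (p.support.Nodup → q.support.Nodup) ∧
      (∀ c w, ins k c w ∈ q.support ↔ w ∈ p.support) ∧
      ∀ c, ∀ w ∈ p.support, s(ins k c w, ins k (!c) w) ∈ q.edges := by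
  induction p generalizing b with
  | @nil x =>
    obtain rfl : e = !b := by simpa using he
    refine ⟨.cons (adj_ins k b x) .nil, fun _ => by simp, fun c w => ?_, fun c w hw => ?_⟩
    · cases c <;> cases b <;> simp
    · obtain rfl : w = x := by simpa using hw
      cases c <;> cases b <;> simp [Sym2.eq_swap]
  | @cons x x' y h p ih =>
    have hx' : par x' = !par x := by
      obtain ⟨j, rfl⟩ := adj_iff.1 h
      exact par_nbr x j
    obtain ⟨q, hq1, hq2, hq3⟩ := ih (!b) (by
      rw [he, hx']; cases b <;> cases par x <;> cases par y <;> rfl)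
    refine ⟨.cons (adj_ins k b x) (.cons (adj_ins_ins k (!b) h) q), ?_, ?_, ?_⟩
    · intro hnd
      rw [SimpleGraph.Walk.support_cons, List.nodup_cons] at hnd
      rw [SimpleGraph.Walk.support_cons, SimpleGraph.Walk.support_cons, List.nodup_cons,
        List.nodup_cons, List.mem_cons]
      refine ⟨?_, ?_, hq1 hnd.2⟩
      · rintro (e | e)
        · rw [ins_inj] at e
          cases b <;> simp at e
        · exact hnd.1 ((hq2 _ _).1 e)
      · exact fun e => hnd.1 ((hq2 _ _).1 e)
    · intro c w
      rw [SimpleGraph.Walk.support_cons, SimpleGraph.Walk.support_cons, List.mem_cons,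
        List.mem_cons, hq2, SimpleGraph.Walk.support_cons, List.mem_cons, ins_inj,
        ins_inj]
      cases c <;> cases b <;> simp
    · intro c w hw
      rw [SimpleGraph.Walk.edges_cons, SimpleGraph.Walk.edges_cons, List.mem_cons, List.mem_cons]
      rw [SimpleGraph.Walk.support_cons, List.mem_cons] at hw
      rcases hw with rfl | hw
      · left
        cases c <;> cases b <;> simp [Sym2.eq_swap]
      · exact Or.inr (Or.inr (hq3 c w hw))

/-! ### Admissible ends in the two subcubes -/

theorem exists_notMem_of_card_lt {s : Finset (Fin n)} (h : s.card < n) : ∃ p, p ∉ s := by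
  by_contra! hs
  rw [Finset.eq_univ_iff_forall.2 hs, Finset.card_univ, Fintype.card_fin] at h
  exact lt_irrefl _ h

theorem exists_ne_ne (hn : 3 ≤ n) (k m : Fin n) : ∃ p, p ≠ k ∧ p ≠ m := by
  obtain ⟨p, hp⟩ := exists_notMem_of_card_lt (s := {k, m}) (Finset.card_le_two.trans_lt hn)
  exact ⟨p, by simpa using hp⟩

theorem exists_ne_ne_ne (hn : 4 ≤ n) (k m l : Fin n) : ∃ p, p ≠ k ∧ p ≠ m ∧ p ≠ l := by
  obtain ⟨p, hp⟩ := exists_notMem_of_card_lt (s := {k, m, l}) (Finset.card_le_three.trans_lt hn)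
  exact ⟨p, by simpa using hp⟩

theorem exists_ne_ne_ne_ne (hn : 5 ≤ n) (k m l i : Fin n) :
    ∃ p, p ≠ k ∧ p ≠ m ∧ p ≠ l ∧ p ≠ i := by
  obtain ⟨p, hp⟩ := exists_notMem_of_card_lt (s := {k, m, l, i})
    (Finset.card_le_four.trans_lt hn)
  exact ⟨p, by simpa using hp⟩

theorem exists_cls_cls {k m : Fin n} (hkm : k ≠ m) (a b : Bool) :
    ∃ w : Vert n, cls k w = a ∧ cls m w = b := by
  obtain ⟨w, hw⟩ : ∃ w : Vert n, cls k w = a := by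
    by_cases h : cls k (fun _ => false) = a
    · exact ⟨_, h⟩
    · exact ⟨nbr (fun _ => false) m, by rw [cls_nbr_of_ne hkm, Bool.eq_not_of_ne h, Bool.not_not]⟩
  by_cases h : cls m w = b
  · exact ⟨w, hw, h⟩
  · exact ⟨nbr w k, by rw [cls_nbr_self, hw],
      by rw [cls_nbr_of_ne hkm.symm, Bool.eq_not_of_ne h, Bool.not_not]⟩

theorem exists_par_cls_cls (hn : 3 ≤ n) {k m : Fin n} (hkm : k ≠ m) (c a b : Bool) :
    ∃ w : Vert n, par w = c ∧ cls k w = a ∧ cls m w = b := by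
  obtain ⟨w, ha, hb⟩ := exists_cls_cls hkm a b
  by_cases h : par w = c
  · exact ⟨w, h, ha, hb⟩
  · obtain ⟨p, hpk, hpm⟩ := exists_ne_ne hn k m
    refine ⟨nbr (nbr (nbr w k) m) p, ?_, ?_, ?_⟩
    · simp only [par_nbr, Bool.not_not]
      rw [Bool.eq_not_of_ne h, Bool.not_not]
    · rw [cls_nbr_of_ne hpk.symm, cls_nbr_of_ne hkm, cls_nbr_self, Bool.not_not, ha]
    · rw [cls_nbr_of_ne hpm.symm, cls_nbr_self, cls_nbr_of_ne hkm.symm, Bool.not_not, hb]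

theorem exists_par_cls (hn : 2 ≤ n) (k : Fin n) (c a : Bool) :
    ∃ w : Vert n, par w = c ∧ cls k w = a := by
  obtain ⟨w, hw, hk⟩ := exists_par_coord hn k c (c ^^ a)
  exact ⟨w, hw, by rw [cls, hw, hk]; cases c <;> cases a <;> rfl⟩

theorem nbr_nbr_nbr_ne {p q r : Fin n} (hpq : p ≠ q) (hpr : p ≠ r) (hqr : q ≠ r) (v : Vert n)
    (i : Fin n) : nbr (nbr (nbr v p) q) r ≠ nbr v i := by
  intro e
  rcases eq_or_ne i p with rfl | hip
  · have := congrFun e q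
    rw [nbr_of_ne _ hqr, nbr_self, nbr_of_ne _ hpq.symm] at this
    simp at this
  · have := congrFun e p
    rw [nbr_of_ne _ hpr, nbr_of_ne _ hpq, nbr_self, nbr_of_ne _ hip.symm] at this
    simp at this

theorem Full.dir_unique {R : Vert n → Vert n → Prop} (hR : IsMatchingRel R) {k m : Fin n}
    {a b : Bool} (hk : Full R k a) (hm : Full R m b) : k = m := by
  by_contra hkm
  obtain ⟨w, ha, hb⟩ := exists_cls_cls hkm a b
  exact hkm (hR.dir_inj (hk w ha) (hm w hb))

theorem Full.admissible {R : Vert n → Vert n → Prop} (hR : IsMatchingRel R) (hn : 4 ≤ n)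
    {k : Fin n} {u x : Vert n} (hk : Full R k (cls k u)) (hpar : par x = !par u)
    (hx : cls k x = !cls k u) : Admissible R u x := by
  have hne : cls k x ≠ cls k u := by rw [hx]; simp
  refine ⟨hpar, ?_, ?_, ?_⟩
  · rintro ⟨m, hm, hfull⟩
    obtain rfl := hk.dir_unique hR hfull
    exact hne hm.symm
  · rintro ⟨m, j, -, rfl, halmost, -, -⟩
    have hkm : k ≠ m := by rintro rfl; exact hne (cls_nbr_self _ _)
    obtain ⟨p, hpk, hpm⟩ := exists_ne_ne (by omega) k m
    obtain ⟨q, hqk, hqm, hqp⟩ := exists_ne_ne_ne hn k m p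
    have hw1 : cls k (nbr (nbr u p) q) = cls k u := by
      rw [cls_nbr_of_ne hqk.symm, cls_nbr_of_ne hpk.symm, Bool.not_not]
    have hw2 : cls m (nbr (nbr u p) q) = cls m u := by
      rw [cls_nbr_of_ne hqm.symm, cls_nbr_of_ne hpm.symm, Bool.not_not]
    have hp : nbr (nbr u p) q p = !u p := by rw [nbr_of_ne _ hqp.symm, nbr_self]
    refine hkm (hR.dir_inj (hk _ hw1) (halmost _ hw2 (fun e => ?_) (fun e => ?_)))
    · rw [e] at hp
      simp at hp
    · rw [e, nbr_of_ne _ hpm] at hp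
      simp at hp
  · intro h
    rw [hR.unique h (hk u rfl), cls_nbr_self] at hne
    exact hne rfl

theorem admissible_of_not_adj {R : Vert n → Vert n → Prop} (hR : IsMatchingRel R) {u x : Vert n}
    (hu : ∀ k, ¬ Full R k (cls k u)) (hpar : par x = !par u) (hx : ∀ i, x ≠ nbr u i) :
    Admissible R u x := by
  refine ⟨hpar, fun ⟨k, _, h⟩ => hu k h, fun ⟨k, _, _, h, _⟩ => hx k h, fun h => ?_⟩
  obtain ⟨i, hi⟩ := adj_iff.1 (hR.adj h)
  exact hx i hi

theorem exists_admissible_of_full {R R' : Vert n → Vert n → Prop} (hR : IsMatchingRel R)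
    (hR' : IsMatchingRel R') (hn : 4 ≤ n) {u v : Vert n} (huv : par u = par v) {k : Fin n}
    (hk : Full R k (cls k u)) (hv : ∀ m, ¬ Full R' m (cls m v)) :
    ∃ x, Admissible R u x ∧ Admissible R' v x := by
  have : Nontrivial (Fin n) := Fin.nontrivial_iff_two_le.2 (by omega)
  obtain ⟨p, hp⟩ := exists_ne k
  obtain ⟨q, hqk, hqp⟩ := exists_ne_ne (by omega) k p
  -- `x` is at distance three from `v`, in the class not covered by the half-layer at `u`.
  by_cases h : cls k v = cls k u
  · obtain ⟨r, hrk, hrp, hrq⟩ := exists_ne_ne_ne hn k p q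
    have hpar : par (nbr (nbr (nbr v p) q) r) = !par v := by simp
    refine ⟨_, hk.admissible hR hn (hpar.trans (by rw [huv])) ?_,
      admissible_of_not_adj hR' hv hpar (nbr_nbr_nbr_ne hqp.symm hrp.symm hrq.symm v)⟩
    rw [cls_nbr_of_ne hrk.symm, cls_nbr_of_ne hqk.symm, cls_nbr_of_ne hp.symm, h, Bool.not_not]
  · have hpar : par (nbr (nbr (nbr v k) p) q) = !par v := by simp
    refine ⟨_, hk.admissible hR hn (hpar.trans (by rw [huv])) ?_,
      admissible_of_not_adj hR' hv hpar (nbr_nbr_nbr_ne hp.symm hqk.symm hqp.symm v)⟩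
    rw [cls_nbr_of_ne hqk.symm, cls_nbr_of_ne hp.symm, cls_nbr_self, Bool.not_not,
      Bool.eq_not_of_ne h]

/-- For matchings `R` and `R'` of the two subcubes and vertices `u` and `v` in them, there is an
edge between the subcubes both of whose ends are admissible, unless `R` and `R'` contain the two
halves of one half-layer that covers both `u` and `v`. -/
theorem exists_admissible {R R' : Vert n → Vert n → Prop} (hR : IsMatchingRel R)
    (hR' : IsMatchingRel R') (hn : 5 ≤ n) {u v : Vert n} (huv : par u = par v)
    (hcls : ∀ k, Full R k (cls k u) → Full R' k (cls k v) → cls k u = cls k v) :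
    ∃ x, Admissible R u x ∧ Admissible R' v x := by
  by_cases hu : ∃ k, Full R k (cls k u)
  · obtain ⟨k, hk⟩ := hu
    by_cases hv : ∃ m, Full R' m (cls m v)
    · obtain ⟨m, hm⟩ := hv
      rcases eq_or_ne k m with rfl | hkm
      · obtain ⟨x, hx, hxk⟩ := exists_par_cls (by omega) k (!par u) (!cls k u)
        exact ⟨x, hk.admissible hR (by omega) hx hxk,
          hm.admissible hR' (by omega) (by rw [hx, huv]) (by rw [hxk, hcls k hk hm])⟩
      · obtain ⟨x, hx, hxk, hxm⟩ :=
          exists_par_cls_cls (by omega) hkm (!par u) (!cls k u) (!cls m v)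
        exact ⟨x, hk.admissible hR (by omega) hx hxk,
          hm.admissible hR' (by omega) (by rw [hx, huv]) hxm⟩
    · exact exists_admissible_of_full hR hR' (by omega) huv hk (not_exists.1 hv)
  · by_cases hv : ∃ m, Full R' m (cls m v)
    · obtain ⟨m, hm⟩ := hv
      obtain ⟨x, h1, h2⟩ := exists_admissible_of_full hR' hR (by omega) huv.symm hm
        (not_exists.1 hu)
      exact ⟨x, h2, h1⟩
    · let f : ℕ → Fin n := fun a => ⟨a % n, Nat.mod_lt _ (by omega)⟩
      have hf : ∀ a b, a < 5 → b < 5 → a ≠ b → f a ≠ f b := by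
        intro a b ha hb hab e
        simp only [f, Fin.mk.injEq] at e
        rw [Nat.mod_eq_of_lt (by omega), Nat.mod_eq_of_lt (by omega)] at e
        exact hab e
      have key : ∀ p q r : Fin n, p ≠ q → p ≠ r → q ≠ r →
          (∀ i, nbr (nbr (nbr v p) q) r ≠ nbr u i) →
          ∃ x, Admissible R u x ∧ Admissible R' v x := by
        intro p q r hpq hpr hqr h
        have hpar : par (nbr (nbr (nbr v p) q) r) = !par v := by simp
        exact ⟨_, admissible_of_not_adj hR (not_exists.1 hu) (hpar.trans (by rw [huv])) h,
          admissible_of_not_adj hR' (not_exists.1 hv) hpar (nbr_nbr_nbr_ne hpq hpr hqr v)⟩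
      -- Two candidates at distance four from each other cannot both be neighbours of `u`.
      by_contra! hno
      have h1 : ∃ i, nbr (nbr (nbr v (f 0)) (f 1)) (f 2) = nbr u i := by
        by_contra! h
        obtain ⟨x, hx, hx'⟩ := key _ _ _ (hf 0 1 (by omega) (by omega) (by omega))
          (hf 0 2 (by omega) (by omega) (by omega)) (hf 1 2 (by omega) (by omega) (by omega)) h
        exact hno x hx hx'
      have h2 : ∃ i, nbr (nbr (nbr v (f 0)) (f 3)) (f 4) = nbr u i := by
        by_contra! h
        obtain ⟨x, hx, hx'⟩ := key _ _ _ (hf 0 3 (by omega) (by omega) (by omega))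
          (hf 0 4 (by omega) (by omega) (by omega)) (hf 3 4 (by omega) (by omega) (by omega)) h
        exact hno x hx hx'
      obtain ⟨i, hi⟩ := h1
      obtain ⟨j, hj⟩ := h2
      have hcov : ∀ a, 1 ≤ a → a < 5 → f a = i ∨ f a = j := by
        intro a h1 h5
        by_contra! hne
        have e1 := congrFun hi (f a)
        have e2 := congrFun hj (f a)
        rw [nbr_of_ne u hne.1] at e1
        rw [nbr_of_ne u hne.2, ← e1] at e2
        have hd : ∀ b, b < 5 → b ≠ a → f a ≠ f b := fun b hb hba => hf a b h5 hb hba.symm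
        interval_cases a
        · rw [nbr_of_ne _ (hd 4 (by omega) (by omega)), nbr_of_ne _ (hd 3 (by omega) (by omega)),
            nbr_of_ne _ (hd 2 (by omega) (by omega)), nbr_self] at e2
          simp at e2
        · rw [nbr_of_ne _ (hd 4 (by omega) (by omega)), nbr_of_ne _ (hd 3 (by omega) (by omega)),
            nbr_self, nbr_of_ne _ (hd 1 (by omega) (by omega))] at e2
          simp at e2
        · rw [nbr_of_ne _ (hd 4 (by omega) (by omega)), nbr_self,
            nbr_of_ne _ (hd 2 (by omega) (by omega)), nbr_of_ne _ (hd 1 (by omega) (by omega))] at e2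
          simp at e2
        · rw [nbr_self, nbr_of_ne _ (hd 3 (by omega) (by omega)),
            nbr_of_ne _ (hd 2 (by omega) (by omega)), nbr_of_ne _ (hd 1 (by omega) (by omega))] at e2
          simp at e2
      have d12 := hf 1 2 (by omega) (by omega) (by omega)
      have d13 := hf 1 3 (by omega) (by omega) (by omega)
      have d23 := hf 2 3 (by omega) (by omega) (by omega)
      have c1 := hcov 1 (by omega) (by omega)
      have c2 := hcov 2 (by omega) (by omega)
      have c3 := hcov 3 (by omega) (by omega)
      grind

/-! ### Both ends in one subcube, with a half-layer in the way -/

theorem exists_only_other_full {R : Vert (n + 1) → Vert (n + 1) → Prop} (hR : IsMatchingRel R)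
    (hn : 1 ≤ n) (k : Fin (n + 1)) :
    ∃ l : Fin n, ∀ m, m ≠ k → ∀ b, Full R m b → m = k.succAbove l := by
  by_cases h : ∃ m, m ≠ k ∧ ∃ b, Full R m b
  · obtain ⟨m, hm, b, hb⟩ := h
    obtain ⟨l, rfl⟩ := Fin.exists_succAbove_eq hm
    exact ⟨l, fun m' _ b' hb' => hb'.dir_unique hR hb⟩
  · exact ⟨⟨0, by omega⟩, fun m hm b hb => absurd ⟨m, hm, b, hb⟩ h⟩

theorem admissible_of_same_coord {R : Vert (n + 1) → Vert (n + 1) → Prop} (hR : IsMatchingRel R)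
    {k : Fin (n + 1)} {l : Fin n} (hl : ∀ m, m ≠ k → ∀ b, Full R m b → m = k.succAbove l)
    {c d : Vert n} (a : Bool) (hcd : c ≠ d) (hpar : par c = par d) (hcoord : c l = d l)
    (hk : ¬ Full R k (par c)) : Admissible R (ins k a c) (ins k (!a) d) := by
  have hnadj : ∀ m, ins k (!a) d ≠ nbr (ins k a c) m := by
    intro m e
    rcases Fin.eq_self_or_eq_succAbove k m with rfl | ⟨m, rfl⟩
    · rw [nbr_ins_same, ins_inj] at e
      exact hcd e.2.symm
    · rw [nbr_ins_succAbove, ins_inj] at e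
      simp at e
  refine ⟨by simp [hpar], ?_, fun ⟨m, _, _, h, _⟩ => hnadj m h, fun h => ?_⟩
  · rintro ⟨m, hm, hfull⟩
    rcases eq_or_ne m k with rfl | hmk
    · rw [cls_ins_same] at hfull
      exact hk hfull
    · obtain rfl := hl m hmk _ hfull
      rw [cls_ins_succAbove, cls_ins_succAbove, cls, cls, hpar, hcoord] at hm
      simp at hm
  · obtain ⟨m, hm⟩ := adj_iff.1 (hR.adj h)
    exact hnadj m hm

theorem Full.eq_nbr {R : Vert n → Vert n → Prop} (hR : IsMatchingRel R) {k : Fin n} {a : Bool}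
    (hk : Full R k a) {x y : Vert n} (h : R x y) : y = nbr x k := by
  by_cases hx : cls k x = a
  · exact hR.unique h (hk x hx)
  · obtain ⟨m, rfl⟩ := adj_iff.1 (hR.adj h)
    by_contra hne
    have hkm : k ≠ m := by rintro rfl; exact hne rfl
    have hy : cls k (nbr x m) = a := by
      rw [cls_nbr_of_ne hkm, Bool.eq_not_of_ne hx, Bool.not_not]
    exact hne (eq_nbr_comm.1 (hR.unique (hR.symm h) (hk _ hy)))

/-- If the first subcube contains a half-layer in direction `k` that covers both ends, then all its
edges have direction `k`; they are traversed by lifting a pair of disjoint paths from the cube in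
which direction `k` is contracted. -/
theorem exists_isCover_of_full {R R' : Vert (n + 2) → Vert (n + 2) → Prop} (hn : 2 ≤ n)
    (hR : IsMatchingRel R) (hR' : IsMatchingRel R') {k : Fin (n + 2)} {u v : Vert (n + 2)}
    (hk : Full R k (cls k u)) (huv : cls k u = cls k v) (hpar : par v = !par u)
    (hne : v ≠ nbr u k) (hk' : ¬ Full R' k (!cls k u)) :
    ∃ (c d : Vert (n + 2)) (p : (graph (n + 2)).Walk u c) (q : (graph (n + 2)).Walk v d),
      IsCover R p q ∧ Admissible R' c d := by
  have hcoord : v k = !u k := by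
    rw [cls, cls, hpar] at huv
    revert huv; cases par u <;> cases u k <;> cases v k <;> simp
  obtain ⟨a, u, v, rfl, rfl⟩ := exists_ins_ne hcoord
  rw [cls_ins_same] at hk hk' huv
  rw [cls_ins_same] at huv
  have huv' : u ≠ v := by rintro rfl; exact hne (nbr_ins_same _ _ _).symm
  obtain ⟨l, hl⟩ := exists_only_other_full hR' (by omega) k
  obtain ⟨c, d, p, q, hc, hd, hcd, hcdl, hpq⟩ := exists_isCover_same_coord hn huv' huv l
  obtain ⟨p', hp1, hp2, hp3⟩ := exists_zigzag k p a a (by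
    rw [hc]; cases a <;> cases par u <;> rfl)
  obtain ⟨q', hq1, hq2, hq3⟩ := exists_zigzag k q (!a) (!a) (by
    rw [hd, huv]; cases a <;> cases par v <;> rfl)
  obtain ⟨hpn, hqn, hdisj⟩ := List.nodup_append.1 hpq.nodup
  refine ⟨_, _, p', q', ⟨?_, fun w => ?_, fun {x y} h => ?_⟩,
    admissible_of_same_coord hR' hl a hcd (hc.trans hd.symm) hcdl (by rwa [hc])⟩
  · rw [List.nodup_append]
    refine ⟨hp1 hpn, hq1 hqn, fun x hx y hy e => ?_⟩
    obtain ⟨x', hx'⟩ := exists_ins k x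
    rw [← e] at hy
    rw [hx'] at hx hy
    exact hdisj _ ((hp2 _ _).1 hx) _ ((hq2 _ _).1 hy) rfl
  · obtain ⟨w', hw⟩ := exists_ins k w
    rw [hw, List.mem_append, hp2, hq2, ← List.mem_append]
    exact hpq.mem w'
  · obtain rfl := hk.eq_nbr hR h
    obtain ⟨x', hx⟩ := exists_ins k x
    rw [hx, nbr_ins_same, List.mem_append]
    exact (List.mem_append.1 (hpq.mem x')).imp (hp3 _ _) (hq3 _ _)

/-- If the first subcube contains an almost half-layer in direction `k` that avoids the two ends,
then the path from `u` leaves the subcube right after its matching edge, and all remaining vertices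
are visited by lifting a path of the cube in which direction `k` is contracted. -/
theorem exists_isCover_of_blocked2 {R R' : Vert (n + 1) → Vert (n + 1) → Prop} (hn : 3 ≤ n)
    (hR : IsMatchingRel R) (hR' : IsMatchingRel R') {k j : Fin (n + 1)} {u v : Vert (n + 1)}
    (hjk : j ≠ k) (hv : v = nbr u k)
    (halmost : ∀ w, cls k w = cls k u → w ≠ u → w ≠ v → R w (nbr w k))
    (hu : R u (nbr u j)) (hvj : R v (nbr v j)) (hk' : ¬ Full R' k (!cls k u)) :
    ∃ (c d : Vert (n + 1)) (p : (graph (n + 1)).Walk u c) (q : (graph (n + 1)).Walk v d),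
      IsCover R p q ∧ Admissible R' c d := by
  obtain ⟨u', hu'⟩ := exists_ins k u
  generalize u k = a at hu'
  subst hu'
  rename' u' => u
  obtain ⟨j, rfl⟩ := Fin.exists_succAbove_eq hjk
  rw [nbr_ins_same] at hv
  subst hv
  rw [nbr_ins_succAbove] at hu hvj
  rw [cls_ins_same] at halmost hk'
  obtain ⟨l, hl⟩ := exists_only_other_full hR' (by omega) k
  set s := nbr u j with hs
  have hspar : par s = !par u := par_nbr u j
  have : Nontrivial (Fin n) := Fin.nontrivial_iff_two_le.2 (by omega)
  obtain ⟨p₁, hp₁⟩ := exists_ne l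
  obtain ⟨p₂, hp₂, hp₁₂⟩ := exists_ne_ne hn l p₁
  obtain ⟨d, hsd, hdpar, hdl⟩ : ∃ d, s ≠ d ∧ par d = par s ∧ s l = d l := by
    refine ⟨nbr (nbr s p₁) p₂, fun e => ?_, by simp, ?_⟩
    · have := congrFun e p₁
      rw [nbr_of_ne _ hp₁₂.symm, nbr_self] at this
      simp at this
    · rw [nbr_of_ne _ hp₂.symm, nbr_of_ne _ hp₁.symm]
  obtain ⟨P, hP, hPu⟩ := exists_path_avoiding hsd hspar (hdpar.trans hspar)
  cases P with
  | nil => exact absurd rfl hsd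
  | @cons _ t _ h P =>
    rw [SimpleGraph.Walk.support_cons, List.nodup_cons] at hP
    have htpar : par t = !par s := by
      obtain ⟨i, rfl⟩ := adj_iff.1 h
      exact par_nbr s i
    have hus : u ≠ s := fun e => by rw [← e] at hspar; simp at hspar
    have hPu' : ∀ w, w ∈ P.support ↔ w ≠ u ∧ w ≠ s := by
      intro w
      have := hPu w
      rw [SimpleGraph.Walk.support_cons, List.mem_cons] at this
      constructor
      · intro hw
        exact ⟨this.1 (Or.inr hw), fun e => hP.1 (e ▸ hw)⟩
      · rintro ⟨h1, h2⟩
        exact (this.2 h1).resolve_left h2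
    obtain ⟨q, hq1, hq2, hq3⟩ := exists_zigzag k P (!a) (!a) (by
      rw [htpar, hdpar]; cases a <;> cases par s <;> rfl)
    have hadj : ∀ b, (graph (n + 1)).Adj (ins k b u) (ins k b s) :=
      fun b => adj_ins_ins k b (adj_nbr u j)
    refine ⟨ins k a s, ins k (!a) d, .cons (hadj a) .nil,
      .cons (hadj (!a)) (.cons (adj_ins_ins k (!a) h) q), ⟨?_, fun w => ?_, fun {x y} hxy => ?_⟩,
      admissible_of_same_coord hR' hl a hsd hdpar.symm hdl (by rwa [hspar])⟩
    · have hnot : ∀ b w, (w = u ∨ w = s) → ins k b w ∉ q.support := by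
        intro b w hw hmem
        have := (hPu' w).1 ((hq2 b w).1 hmem)
        exact hw.elim this.1 this.2
      have := hnot a u (Or.inl rfl)
      have := hnot (!a) u (Or.inl rfl)
      have := hnot a s (Or.inr rfl)
      have := hnot (!a) s (Or.inr rfl)
      simp_all [hq1 hP.2]
    · obtain ⟨w', hw⟩ := exists_ins k w
      rw [hw]
      by_cases h1 : w' = u
      · rcases eq_or_ne (w k) a with h3 | h3
        · simp [h1, h3]
        · simp [h1, Bool.eq_not_of_ne h3]
      · by_cases h2 : w' = s
        · rcases eq_or_ne (w k) a with h3 | h3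
          · simp [h2, h3]
          · simp [h2, Bool.eq_not_of_ne h3]
        · have := (hq2 (w k) w').2 ((hPu' w').2 ⟨h1, h2⟩)
          simp [this]
    · -- Away from `u` and `s` all edges of `R` have direction `k`.
      have hRs : ∀ b, R (ins k b u) (ins k b s) := by
        intro b
        rcases eq_or_ne b a with rfl | h3
        · exact hu
        · rw [Bool.eq_not_of_ne h3]; exact hvj
      have hedge : ∀ b, s(ins k b u, ins k b s) ∈
          (SimpleGraph.Walk.cons (hadj a) .nil).edges ++
            (SimpleGraph.Walk.cons (hadj (!a)) (.cons (adj_ins_ins k (!a) h) q)).edges := by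
        intro b
        rcases eq_or_ne b a with rfl | h3
        · simp
        · rw [Bool.eq_not_of_ne h3]; simp
      obtain ⟨w, hw⟩ := exists_ins k x
      generalize x k = b at hw
      subst hw
      by_cases h1 : w = u
      · rw [h1] at hxy ⊢
        rw [hR.unique hxy (hRs b)]
        exact hedge b
      by_cases h2 : w = s
      · rw [h2] at hxy ⊢
        rw [hR.unique hxy (hR.symm (hRs b)), Sym2.eq_swap]
        exact hedge b
      have halmost' : ∀ b w, par w = par u → w ≠ u → R (ins k b w) (ins k (!b) w) := by
        intro b w hw hwu
        rw [← nbr_ins_same]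
        exact halmost _ (by rw [cls_ins_same, hw]) (by simp [hwu]) (by simp [hwu])
      have hy : y = ins k (!b) w := by
        by_cases hpw : par w = par u
        · exact hR.unique hxy (halmost' b w hpw h1)
        · obtain ⟨m, hm⟩ := adj_iff.1 (hR.adj hxy)
          rcases Fin.eq_self_or_eq_succAbove k m with rfl | ⟨m, rfl⟩
          · rw [hm, nbr_ins_same]
          · rw [nbr_ins_succAbove] at hm
            subst hm
            have hmu : nbr w m ≠ u := by
              intro e
              rw [e] at hxy
              exact h2 (ins_inj.1 (hR.unique (hR.symm hxy) (hRs b))).2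
            have := hR.unique (hR.symm hxy)
              (halmost' b (nbr w m) (by rw [par_nbr, Bool.eq_not_of_ne hpw, Bool.not_not]) hmu)
            simp at this
      rw [hy]
      have := hq3 b w ((hPu' w).2 ⟨h1, h2⟩)
      simp [this]

/-! ### Comparing two paths with the same ends -/

section Comparison

variable {V : Type*} {G : SimpleGraph V}

theorem eq_of_edges_subset {u v : V} {p q : G.Walk u v} (hp : p.IsPath) (hq : q.IsPath)
    (h : ∀ e ∈ p.edges, e ∈ q.edges) : p = q := by
  induction p with
  | nil =>
    cases q with
    | nil => rfl
    | cons _ q => exact absurd q.end_mem_support ((SimpleGraph.Walk.cons_isPath_iff _ _).1 hq).2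
  | @cons u x v hux p ih =>
    rw [SimpleGraph.Walk.cons_isPath_iff] at hp
    cases q with
    | nil => exact absurd p.end_mem_support hp.2
    | @cons _ y _ huy q =>
      rw [SimpleGraph.Walk.cons_isPath_iff] at hq
      have hxy : x = y := by
        have := h s(u, x) (by simp)
        rw [SimpleGraph.Walk.edges_cons, List.mem_cons] at this
        rcases this with e | e
        · exact Sym2.congr_right.1 e
        · exact absurd (q.fst_mem_support_of_mem_edges e) hq.2
      subst hxy
      rw [ih hp.1 hq.1 fun e he => ?_]
      have := h e (by simp [he])
      rw [SimpleGraph.Walk.edges_cons, List.mem_cons] at this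
      refine this.resolve_left ?_
      rintro rfl
      exact hp.2 (p.fst_mem_support_of_mem_edges he)

theorem ncard_neighborSet_start {u v : V} {p : G.Walk u v} (hp : p.IsPath) (huv : u ≠ v) :
    (p.toSubgraph.neighborSet u).ncard = 1 := by
  rw [hp.neighborSet_toSubgraph_startpoint (SimpleGraph.Walk.not_nil_of_ne huv),
    Set.ncard_singleton]

theorem ncard_neighborSet_end {u v : V} {p : G.Walk u v} (hp : p.IsPath) (huv : u ≠ v) :
    (p.toSubgraph.neighborSet v).ncard = 1 := by
  rw [hp.neighborSet_toSubgraph_endpoint (SimpleGraph.Walk.not_nil_of_ne huv),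
    Set.ncard_singleton]

theorem ncard_neighborSet_inner {u v w : V} {p : G.Walk u v} (hp : p.IsPath)
    (hw : w ∈ p.support) (hwu : w ≠ u) (hwv : w ≠ v) :
    (p.toSubgraph.neighborSet w).ncard = 2 := by
  obtain ⟨i, rfl, hi⟩ := SimpleGraph.Walk.mem_support_iff_exists_getVert.1 hw
  refine hp.ncard_neighborSet_toSubgraph_internal_eq_two ?_ (lt_of_le_of_ne hi ?_)
  · rintro rfl; exact hwu p.getVert_zero
  · rintro rfl; exact hwv p.getVert_length

/-- Two Hamilton paths with the same ends have equal degrees, so at each vertex the edges of the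
first that are missing from the second are balanced by edges of the second. -/
theorem exists_mem_edges_of_notMem {u v : V} (huv : u ≠ v) {p q : G.Walk u v} (hp : p.IsPath)
    (hq : q.IsPath) (hpm : ∀ w, w ∈ p.support) (hqm : ∀ w, w ∈ q.support) {x y : V}
    (h : s(x, y) ∈ p.edges) (h' : s(x, y) ∉ q.edges) :
    ∃ z, s(x, z) ∈ q.edges ∧ s(x, z) ∉ p.edges := by
  have hcard : (p.toSubgraph.neighborSet x).ncard = (q.toSubgraph.neighborSet x).ncard := by
    rcases eq_or_ne x u with rfl | hxu
    · rw [ncard_neighborSet_start hp huv, ncard_neighborSet_start hq huv]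
    rcases eq_or_ne x v with rfl | hxv
    · rw [ncard_neighborSet_end hp huv, ncard_neighborSet_end hq huv]
    rw [ncard_neighborSet_inner hp (hpm x) hxu hxv, ncard_neighborSet_inner hq (hqm x) hxu hxv]
  by_contra! hno
  have hsub : q.toSubgraph.neighborSet x ⊆ p.toSubgraph.neighborSet x := by
    intro z hz
    rw [SimpleGraph.Subgraph.mem_neighborSet,
      SimpleGraph.Walk.adj_toSubgraph_iff_mem_edges] at hz ⊢
    exact hno z hz
  have heq := Set.eq_of_subset_of_ncard_le hsub hcard.le p.finite_neighborSet_toSubgraph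
  refine h' ?_
  rw [← SimpleGraph.Walk.adj_toSubgraph_iff_mem_edges, ← SimpleGraph.Subgraph.mem_neighborSet, heq,
    SimpleGraph.Subgraph.mem_neighborSet, SimpleGraph.Walk.adj_toSubgraph_iff_mem_edges]
  exact h

theorem exists_split {u v : V} {p : G.Walk u v} {e : Sym2 V} (he : e ∈ p.edges) :
    ∃ (a b : V) (h : G.Adj a b) (A : G.Walk u a) (B : G.Walk b v),
      e = s(a, b) ∧ p = A.append (.cons h B) := by
  induction p with
  | nil => simp at he
  | @cons u x v h p ih =>
    rw [SimpleGraph.Walk.edges_cons, List.mem_cons] at he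
    rcases he with rfl | he
    · exact ⟨u, x, h, .nil, p, rfl, rfl⟩
    · obtain ⟨a, b, h', A, B, rfl, rfl⟩ := ih he
      exact ⟨a, b, h', .cons h A, B, rfl, rfl⟩

theorem exists_split_two {u v : V} {p : G.Walk u v} {e f : Sym2 V} (he : e ∈ p.edges)
    (hf : f ∈ p.edges) (hef : e ≠ f) :
    ∃ (a b c d : V) (h : G.Adj a b) (h' : G.Adj c d) (A : G.Walk u a) (B : G.Walk b c)
      (C : G.Walk d v), p = A.append (.cons h (B.append (.cons h' C))) ∧
        ((e = s(a, b) ∧ f = s(c, d)) ∨ (f = s(a, b) ∧ e = s(c, d))) := by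
  obtain ⟨a, b, h, A, B, rfl, rfl⟩ := exists_split he
  rw [SimpleGraph.Walk.edges_append, SimpleGraph.Walk.edges_cons, List.mem_append,
    List.mem_cons] at hf
  rcases hf with hf | hf | hf
  · obtain ⟨c, d, h', A, A', rfl, rfl⟩ := exists_split hf
    refine ⟨c, d, a, b, h', h, A, A', B, ?_, Or.inr ⟨rfl, rfl⟩⟩
    rw [← SimpleGraph.Walk.append_assoc, SimpleGraph.Walk.cons_append]
  · exact absurd hf.symm hef
  · obtain ⟨c, d, h', B, B', rfl, rfl⟩ := exists_split hf
    exact ⟨a, b, c, d, h, h', A, B, B', rfl, Or.inl ⟨rfl, rfl⟩⟩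

theorem support_subset_of_edges_closed {S : V → Prop} {u v : V} (p : G.Walk u v)
    (h : ∀ x y, s(x, y) ∈ p.edges → (S x ↔ S y)) (hu : S u) : ∀ w ∈ p.support, S w := by
  induction p with
  | nil => simpa using hu
  | cons hux p ih =>
    intro w hw
    rw [SimpleGraph.Walk.support_cons, List.mem_cons] at hw
    rcases hw with rfl | hw
    · exact hu
    · exact ih (fun x y hxy => h x y (by simp [hxy])) ((h _ _ (by simp)).1 hu) w hw

/-- Replacing two edges `ab` and `cd` of a path, traversed in this order, by `bc` and `ad` cuts off
the segment from `b` to `c`. -/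
theorem notMem_support_of_exchange {u v a b c d : V} {h : G.Adj a b} {h' : G.Adj c d}
    {A : G.Walk u a} {B : G.Walk b c} {C : G.Walk d v}
    (hnd : (A.append (.cons h (B.append (.cons h' C)))).IsPath) (q : G.Walk u v)
    (hq : ∀ e ∈ q.edges, (e ∈ (A.append (.cons h (B.append (.cons h' C)))).edges ∧
      e ≠ s(a, b) ∧ e ≠ s(c, d)) ∨ e = s(b, c) ∨ e = s(a, d)) : b ∉ q.support := by
  have hnd' : (A.support ++ (B.support ++ C.support)).Nodup := by
    have := hnd.support_nodup
    rwa [SimpleGraph.Walk.support_append, SimpleGraph.Walk.support_cons, List.tail_cons,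
      SimpleGraph.Walk.support_append, SimpleGraph.Walk.support_cons, List.tail_cons] at this
  obtain ⟨-, hBC, hA⟩ := List.nodup_append.1 hnd'
  obtain ⟨-, -, hC⟩ := List.nodup_append.1 hBC
  have hAB : ∀ x ∈ A.support, x ∉ B.support :=
    fun x hx hx' => hA x hx x (List.mem_append_left _ hx') rfl
  have hCB : ∀ x ∈ C.support, x ∉ B.support := fun x hx hx' => hC x hx' x hx rfl
  refine fun hb => support_subset_of_edges_closed (S := fun w => w ∉ B.support) q ?_
    (hAB u A.start_mem_support) b hb B.start_mem_support
  intro x y hxy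
  have ha := hAB a A.end_mem_support
  have hd := hCB d C.start_mem_support
  rcases hq _ hxy with ⟨hmem, h1, h2⟩ | e | e
  · simp only [SimpleGraph.Walk.edges_append, SimpleGraph.Walk.edges_cons, List.mem_append,
      List.mem_cons] at hmem
    rcases hmem with hm | hm | hm | hm | hm
    · exact iff_of_true (hAB x (A.fst_mem_support_of_mem_edges hm))
        (hAB y (A.snd_mem_support_of_mem_edges hm))
    · exact absurd hm h1
    · exact iff_of_false (not_not.2 (B.fst_mem_support_of_mem_edges hm))
        (not_not.2 (B.snd_mem_support_of_mem_edges hm))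
    · exact absurd hm h2
    · exact iff_of_true (hCB x (C.fst_mem_support_of_mem_edges hm))
        (hCB y (C.snd_mem_support_of_mem_edges hm))
  · rcases Sym2.eq_iff.1 e with ⟨rfl, rfl⟩ | ⟨rfl, rfl⟩ <;>
      simp [B.start_mem_support, B.end_mem_support]
  · rcases Sym2.eq_iff.1 e with ⟨rfl, rfl⟩ | ⟨rfl, rfl⟩ <;> simp [ha, hd]

end Comparison

theorem par_of_adj {u v : Vert n} (h : (graph n).Adj u v) : par v = !par u := by
  obtain ⟨i, rfl⟩ := adj_iff.1 h
  exact par_nbr u i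

/-- A path contained in the union of two matchings alternates between them, so the parity of the
vertex from which it traverses an edge decides to which of them the edge belongs. -/
theorem alternating {R R' : Vert n → Vert n → Prop} (hR : IsMatchingRel R)
    (hR' : IsMatchingRel R') {x y v : Vert n} (h : (graph n).Adj x y) (p : (graph n).Walk y v)
    (hp : (SimpleGraph.Walk.cons h p).IsPath)
    (hRR' : ∀ a b, s(a, b) ∈ (SimpleGraph.Walk.cons h p).edges → R a b ∨ R' a b) :
    ∀ d ∈ (SimpleGraph.Walk.cons h p).darts, (R d.fst d.snd ↔ (R x y ↔ par d.fst = par x)) := by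
  induction p generalizing x with
  | nil =>
    intro d hd
    simp only [SimpleGraph.Walk.darts_cons, SimpleGraph.Walk.darts_nil, List.mem_singleton] at hd
    subst hd
    simp
  | @cons y z v h' p ih =>
    intro d hd
    rw [SimpleGraph.Walk.darts_cons, List.mem_cons] at hd
    rcases hd with rfl | hd
    · simp
    · have hp' := hp
      rw [SimpleGraph.Walk.cons_isPath_iff] at hp'
      have hxz : x ≠ z := by
        rintro rfl
        exact hp'.2 (by simp)
      rw [ih h' hp'.1 (fun a b hab => hRR' a b (by
        rw [SimpleGraph.Walk.edges_cons]; exact List.mem_cons_of_mem _ hab)) d hd, par_of_adj h]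
      have h1 : R y z ↔ ¬ R x y := by
        constructor
        · exact fun h1 h2 => hxz (hR.unique (hR.symm h2) h1)
        · intro h2
          by_contra h3
          exact hxz (hR'.unique (hR'.symm ((hRR' x y (by simp)).resolve_left h2))
            ((hRR' y z (by simp)).resolve_left h3))
      rw [h1]
      by_cases h2 : R x y <;> cases par d.fst <;> cases par x <;> simp [h2]

/-! ### Obstructed pairs of adjacent vertices -/

theorem Blocked2.symm {R : Vert n → Vert n → Prop} {u v : Vert n} (h : Blocked2 R u v) :
    Blocked2 R v u := by
  obtain ⟨k, j, hjk, hv, halmost, h1, h2⟩ := h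
  refine ⟨k, j, hjk, eq_nbr_comm.1 hv, fun w hw hwv hwu => halmost w ?_ hwu hwv, h2, h1⟩
  rw [hw, hv, cls_nbr_self]

theorem Blocked2.not_rel {R : Vert n → Vert n → Prop} (hR : IsMatchingRel R) {u v : Vert n}
    (h : Blocked2 R u v) : ¬ R u v := by
  obtain ⟨k, j, hjk, rfl, -, h1, -⟩ := h
  exact fun h => hjk (hR.dir_inj h1 h)

theorem admissible_of_adj {R : Vert n → Vert n → Prop} {x y : Vert n}
    (h : (graph n).Adj x y) (h3 : ¬ R x y) (h2 : ¬ Blocked2 R x y) : Admissible R x y := by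
  refine ⟨par_of_adj h, ?_, h2, h3⟩
  rintro ⟨k, hk, hfull⟩
  obtain ⟨i, rfl⟩ := adj_iff.1 h
  rcases eq_or_ne k i with rfl | hki
  · exact h3 (hfull x rfl)
  · rw [cls_nbr_of_ne hki] at hk
    simp at hk

theorem Blocked2.dir_unique {R : Vert n → Vert n → Prop} (hR : IsMatchingRel R) (hn : 5 ≤ n)
    {x x' : Vert n} {k k' : Fin n}
    (h : ∀ w, cls k w = cls k x → w ≠ x → w ≠ nbr x k → R w (nbr w k))
    (h' : ∀ w, cls k' w = cls k' x' → w ≠ x' → w ≠ nbr x' k' → R w (nbr w k')) : k = k' := by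
  by_contra hkk
  have key : ∀ w, cls k w = cls k x → cls k' w = cls k' x' → w ≠ x → w ≠ nbr x k →
      w = x' ∨ w = nbr x' k' := by
    intro w h1 h2 h3 h4
    by_contra! h5
    exact hkk (hR.dir_inj (h w h1 h3 h4) (h' w h2 h5.1 h5.2))
  -- Two vertices at distance two in the intersection of the two classes; at least one of them
  -- avoids all four exceptional vertices.
  obtain ⟨w, hwx, hw, hw'⟩ : ∃ w, (w = x ∨ w = nbr x k) ∧ cls k w = cls k x ∧
      cls k' w = cls k' x' := by
    by_cases hx : cls k' x = cls k' x'
    · exact ⟨x, Or.inl rfl, rfl, hx⟩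
    · refine ⟨nbr x k, Or.inr rfl, cls_nbr_self k x, ?_⟩
      rw [cls_nbr_of_ne (Ne.symm hkk), Bool.eq_not_of_ne hx, Bool.not_not]
  have hwl : ∀ l, l ≠ k → x l = w l ∧ nbr x k l = w l := by
    intro l hl
    rcases hwx with rfl | rfl <;> simp [nbr_of_ne _ hl]
  obtain ⟨p, hpk, hpk'⟩ := exists_ne_ne (by omega) k k'
  obtain ⟨q, hqk, hqk', hqp⟩ := exists_ne_ne_ne (by omega) k k' p
  obtain ⟨r, hrk, hrk', hrp, hrq⟩ := exists_ne_ne_ne_ne hn k k' p q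
  have hcand : ∀ s, s ≠ k → s ≠ k' → s ≠ p →
      nbr (nbr w p) s = x' ∨ nbr (nbr w p) s = nbr x' k' := by
    intro s hsk hsk' hsp
    have hp : nbr (nbr w p) s p = !w p := by rw [nbr_of_ne _ hsp.symm, nbr_self]
    refine key _ ?_ ?_ (fun e => ?_) (fun e => ?_)
    · rw [cls_nbr_of_ne hsk.symm, cls_nbr_of_ne hpk.symm, Bool.not_not, hw]
    · rw [cls_nbr_of_ne hsk'.symm, cls_nbr_of_ne hpk'.symm, Bool.not_not, hw']
    · rw [e, (hwl p hpk).1] at hp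
      simp at hp
    · rw [e, (hwl p hpk).2] at hp
      simp at hp
  have hq : ∀ z, z = x' ∨ z = nbr x' k' → z q = x' q := by
    rintro z (rfl | rfl)
    · rfl
    · exact nbr_of_ne _ hqk'
  have e1 := hq _ (hcand q hqk hqk' hqp)
  have e2 := hq _ (hcand r hrk hrk' hrp)
  rw [nbr_self, nbr_of_ne _ hqp] at e1
  rw [nbr_of_ne _ hrq.symm, nbr_of_ne _ hqp, ← e1] at e2
  simp at e2

/-- Two edges for which C2 holds are equal or opposite sides of a four-cycle whose other two sides
belong to the matching. -/
theorem Blocked2.eq_or_opposite {R : Vert n → Vert n → Prop} (hR : IsMatchingRel R) (hn : 5 ≤ n)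
    {x y x' y' : Vert n} (h : Blocked2 R x y) (h' : Blocked2 R x' y') :
    s(x, y) = s(x', y') ∨ (R x x' ∧ R y y') ∨ (R x y' ∧ R y x') := by
  obtain ⟨k, j, hjk, rfl, halmost, h1, h2⟩ := h
  obtain ⟨k', j', hjk', rfl, halmost', h1', h2'⟩ := h'
  obtain rfl := Blocked2.dir_unique hR hn halmost halmost'
  by_cases hc : cls k x' = cls k x
  · left
    by_contra hne
    refine hjk' (hR.dir_inj h1' (halmost x' hc ?_ ?_))
    · rintro rfl; exact hne rfl
    · rintro rfl; exact hne (by rw [nbr_nbr, Sym2.eq_swap])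
  · right
    have hs : nbr x j = x' ∨ nbr x j = nbr x' k := by
      by_contra! hne
      have := halmost' (nbr x j) (by
        rw [cls_nbr_of_ne hjk.symm, Bool.eq_not_of_ne hc]) hne.1 hne.2
      exact hjk (nbr_dir_inj ((nbr_nbr x j).trans (hR.unique (hR.symm h1) this)))
    have ht : nbr (nbr x k) j = nbr (nbr x j) k := nbr_comm x k j
    rcases hs with hs | hs
    · left
      rw [ht, hs] at h2
      rw [hs] at h1
      exact ⟨h1, h2⟩
    · right
      rw [ht, hs, nbr_nbr] at h2
      rw [hs] at h1
      exact ⟨h1, h2⟩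

/-- Of two distinct Hamilton paths that contain `R`, one has an edge outside `R` whose ends are
admissible for `R'`. Otherwise the symmetric difference of the two paths is a four-cycle, and then
exchanging opposite sides of it in the path that alternates between `R` and `R'` would
disconnect that path. -/
theorem exists_admissible_edge {R R' : Vert n → Vert n → Prop} (hR : IsMatchingRel R)
    (hR' : IsMatchingRel R') (hn : 5 ≤ n) {u v : Vert n} (huv : u ≠ v) (h : TwoPaths R u v) :
    ∃ (a b : Vert n) (e : (graph n).Adj a b) (A : (graph n).Walk u a) (B : (graph n).Walk b v),
      IsHam R (A.append (.cons e B)) ∧ ¬ R a b ∧ Admissible R' a b := by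
  by_contra! hno
  have hbad : ∀ p : (graph n).Walk u v, IsHam R p → ∀ x y, s(x, y) ∈ p.edges → ¬ R x y →
      R' x y ∨ Blocked2 R' x y := by
    intro p hp x y hxy hRxy
    obtain ⟨a, b, e, A, B, hab, rfl⟩ := exists_split hxy
    by_contra! hc
    rcases Sym2.eq_iff.1 hab with ⟨rfl, rfl⟩ | ⟨rfl, rfl⟩
    · exact hno x y e A B hp hRxy (admissible_of_adj e hc.1 hc.2)
    · exact hno y x e A B hp (fun h => hRxy (hR.symm h))
        (admissible_of_adj e (fun h => hc.1 (hR'.symm h)) (fun h => hc.2 h.symm))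
  have hbal : ∀ p q : (graph n).Walk u v, IsHam R p → IsHam R q → ∀ x y, s(x, y) ∈ p.edges →
      s(x, y) ∉ q.edges → ∃ z, s(x, z) ∈ q.edges ∧ s(x, z) ∉ p.edges :=
    fun p q hp hq x y h h' => exists_mem_edges_of_notMem huv
      ((SimpleGraph.Walk.isPath_def _).2 hp.nodup) ((SimpleGraph.Walk.isPath_def _).2 hq.nodup)
      hp.mem hq.mem h h'
  have hirr : ∀ {a b}, R' a b → a ≠ b := fun h => (hR'.adj h).ne
  -- No edge of the symmetric difference satisfies C2.
  have main : ∀ p q : (graph n).Walk u v, IsHam R p → IsHam R q → ∀ x y, s(x, y) ∈ p.edges →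
      s(x, y) ∉ q.edges → ¬ Blocked2 R' x y := by
    intro p q hp hq x y hxy hxy' hB
    have hnR : ¬ R' x y := hB.not_rel hR'
    obtain ⟨z, hxz, hxz'⟩ := hbal p q hp hq x y hxy hxy'
    have hRxz : ¬ R x z := fun h => hxz' (hp.rel h)
    have hR'xz : R' x z := by
      refine (hbad q hq x z hxz hRxz).resolve_right fun hB' => ?_
      rcases hB.eq_or_opposite hR' hn hB' with e | ⟨e, -⟩ | ⟨e, e'⟩
      · exact hxy' (e ▸ hxz)
      · exact hirr e rfl
      · exact hnR (hR'.symm e')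
    obtain ⟨t, hyt, hyt'⟩ := hbal p q hp hq y x (by rwa [Sym2.eq_swap]) (by rwa [Sym2.eq_swap])
    have hRyt : ¬ R y t := fun h => hyt' (hp.rel h)
    have hR'yt : R' y t := by
      refine (hbad q hq y t hyt hRyt).resolve_right fun hB' => ?_
      rcases hB.eq_or_opposite hR' hn hB' with e | ⟨e, -⟩ | ⟨e, e'⟩
      · exact hxy' (e ▸ hyt)
      · exact hnR e
      · exact hirr e' rfl
    obtain ⟨w, hzw, hzw'⟩ := hbal q p hq hp z x (by rwa [Sym2.eq_swap]) (by rwa [Sym2.eq_swap])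
    have hBzw : Blocked2 R' z w := by
      refine (hbad p hp z w hzw fun h => hzw' (hq.rel h)).resolve_left fun hR'zw => ?_
      rw [hR'.unique hR'zw (hR'.symm hR'xz), Sym2.eq_swap] at hzw
      exact hxz' hzw
    obtain rfl : w = t := by
      rcases hB.eq_or_opposite hR' hn hBzw with e | ⟨-, e⟩ | ⟨-, e⟩
      · rcases Sym2.eq_iff.1 e with ⟨rfl, -⟩ | ⟨-, rfl⟩
        · exact absurd rfl (hirr hR'xz)
        · exact absurd hR'xz hnR
      · exact hR'.unique e hR'yt
      · have := hR'.unique (hR'.symm e) (hR'.symm hR'xz)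
        exact absurd (this ▸ hxy) (fun h => (p.adj_of_mem_edges h).ne rfl)
    have hopp : ∀ a b, Blocked2 R' a b → s(a, b) = s(x, y) ∨ s(a, b) = s(z, w) := by
      intro a b hab
      rcases hB.eq_or_opposite hR' hn hab with e | ⟨e, e'⟩ | ⟨e, e'⟩
      · exact Or.inl e.symm
      · exact Or.inr (by rw [hR'.unique e hR'xz, hR'.unique e' hR'yt])
      · exact Or.inr (by rw [hR'.unique e hR'xz, hR'.unique e' hR'yt, Sym2.eq_swap])
    have hq2 : ∀ a b, s(a, b) ∈ q.edges → ¬ Blocked2 R' a b := by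
      intro a b hab hBab
      rcases hopp a b hBab with e | e
      · exact hxy' (e ▸ hab)
      · exact hzw' (e ▸ hab)
    have hqRR' : ∀ a b, s(a, b) ∈ q.edges → R a b ∨ R' a b := by
      intro a b hab
      by_cases hRab : R a b
      · exact Or.inl hRab
      · exact Or.inr ((hbad q hq a b hab hRab).resolve_right (hq2 a b hab))
    have hpq : ∀ e ∈ p.edges, (e ∈ q.edges ∧ e ≠ s(x, z) ∧ e ≠ s(y, w)) ∨ e = s(x, y) ∨
        e = s(z, w) := by
      intro e he
      induction e with
      | _ a b =>
      by_cases hab : s(a, b) ∈ q.edges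
      · exact Or.inl ⟨hab, fun h => hxz' (h ▸ he), fun h => hyt' (h ▸ he)⟩
      · refine Or.inr (hopp a b ?_)
        refine (hbad p hp a b he fun h => hab (hq.rel h)).resolve_left fun hR'ab => ?_
        obtain ⟨c, hc, hc'⟩ := hbal p q hp hq a b he hab
        rcases hqRR' a c hc with h | h
        · exact hc' (hp.rel h)
        · exact hab (hR'.unique hR'ab h ▸ hc)
    have hne : s(x, z) ≠ s(y, w) := by
      intro e
      rcases Sym2.eq_iff.1 e with ⟨rfl, -⟩ | ⟨rfl, rfl⟩
      · exact (p.adj_of_mem_edges hxy).ne rfl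
      · exact hnR hR'xz
    have hpy : par y = !par x := par_of_adj (p.adj_of_mem_edges hxy)
    have hpz : par z = !par x := par_of_adj (q.adj_of_mem_edges hxz)
    have hpw : par w = par x := by rw [par_of_adj (q.adj_of_mem_edges hyt), hpy, Bool.not_not]
    obtain ⟨a, b, c, d, e₁, e₂, A, B, C, rfl, hABC⟩ := exists_split_two hxz hyt hne
    have hqpath := (SimpleGraph.Walk.isPath_def _).2 hq.nodup
    have hnab : ¬ R a b := by
      intro hRab
      rcases hABC with ⟨e, -⟩ | ⟨e, -⟩
      · exact hxz' (e ▸ hp.rel hRab)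
      · exact hyt' (e ▸ hp.rel hRab)
    have hncd : ¬ R c d := by
      intro hRcd
      rcases hABC with ⟨-, e⟩ | ⟨-, e⟩
      · exact hyt' (e ▸ hp.rel hRcd)
      · exact hxz' (e ▸ hp.rel hRcd)
    have hpar : par c = par a := by
      have := alternating hR hR' e₁ (B.append (.cons e₂ C)) hqpath.of_append_right
        (fun a' b' hab => hqRR' a' b' (by
          rw [SimpleGraph.Walk.edges_append]; exact List.mem_append_right _ hab)) ⟨(c, d), e₂⟩
          (by simp)
      simpa [hnab, hncd] using this
    refine notMem_support_of_exchange hqpath p (fun e he => ?_) (hp.mem b)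
    have hcase : (s(b, c) = s(x, y) ∧ s(a, d) = s(z, w)) ∨
        (s(b, c) = s(z, w) ∧ s(a, d) = s(x, y)) := by
      rcases hABC with ⟨h1, h2⟩ | ⟨h1, h2⟩ <;>
      rcases Sym2.eq_iff.1 h1 with ⟨rfl, rfl⟩ | ⟨rfl, rfl⟩ <;>
      rcases Sym2.eq_iff.1 h2 with ⟨rfl, rfl⟩ | ⟨rfl, rfl⟩ <;>
      first
        | (exfalso; simp [hpy, hpz, hpw] at hpar; done)
        | exact Or.inl ⟨by first | rfl | exact Sym2.eq_swap, by first | rfl | exact Sym2.eq_swap⟩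
        | exact Or.inr ⟨by first | rfl | exact Sym2.eq_swap, by first | rfl | exact Sym2.eq_swap⟩
    rcases hpq e he with ⟨h0, h1, h2⟩ | h0 | h0
    · left
      refine ⟨h0, ?_, ?_⟩
      · rcases hABC with ⟨h3, h4⟩ | ⟨h3, h4⟩
        · rwa [← h3]
        · rwa [← h3]
      · rcases hABC with ⟨h3, h4⟩ | ⟨h3, h4⟩
        · rwa [← h4]
        · rwa [← h4]
    · right
      rcases hcase with ⟨h3, h4⟩ | ⟨h3, h4⟩
      · exact Or.inl (h0.trans h3.symm)
      · exact Or.inr (h0.trans h4.symm)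
    · right
      rcases hcase with ⟨h3, h4⟩ | ⟨h3, h4⟩
      · exact Or.inr (h0.trans h4.symm)
      · exact Or.inl (h0.trans h3.symm)
  obtain ⟨p, q, hpq, hp, hq⟩ := h
  refine hpq (eq_of_edges_subset ((SimpleGraph.Walk.isPath_def _).2 hp.nodup)
    ((SimpleGraph.Walk.isPath_def _).2 hq.nodup) fun e he => ?_)
  induction e with
  | _ x y =>
  by_contra hxy
  have h1 := (hbad p hp x y he fun h => hxy (hq.rel h)).resolve_right (main p q hp hq x y he hxy)
  obtain ⟨z, hz, hz'⟩ := hbal p q hp hq x y he hxy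
  have h2 := (hbad q hq x z hz fun h => hz' (hp.rel h)).resolve_right (main q p hq hp x z hz hz')
  exact hxy (hR'.unique h1 h2 ▸ hz)

/-! ### The induction -/

theorem isCover_of_isHam {R : Vert n → Vert n → Prop} (hR : IsMatchingRel R) {u v a b : Vert n}
    {e : (graph n).Adj a b} {A : (graph n).Walk u a} {B : (graph n).Walk b v}
    (h : IsHam R (A.append (.cons e B))) (hab : ¬ R a b) : IsCover R A B.reverse := by
  have hsupp : (A.append (.cons e B)).support = A.support ++ B.support := by
    rw [SimpleGraph.Walk.support_append, SimpleGraph.Walk.support_cons, List.tail_cons]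
  refine ⟨?_, fun w => ?_, fun {x y} hxy => ?_⟩
  · have := h.nodup
    rw [hsupp] at this
    rw [SimpleGraph.Walk.support_reverse]
    exact (List.Perm.append_left _ (List.reverse_perm _)).nodup_iff.2 this
  · have := h.mem w
    rw [hsupp] at this
    simpa using this
  · have := h.rel hxy
    rw [SimpleGraph.Walk.edges_append, SimpleGraph.Walk.edges_cons, List.mem_append,
      List.mem_cons] at this
    rw [SimpleGraph.Walk.edges_reverse, List.mem_append, List.mem_reverse]
    refine this.imp_right fun h => h.resolve_left fun e => ?_
    rcases Sym2.eq_iff.1 e with ⟨rfl, rfl⟩ | ⟨rfl, rfl⟩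
    · exact hab hxy
    · exact hab (hR.symm hxy)

theorem full_of_restr {R : Vert (n + 1) → Vert (n + 1) → Prop} {i : Fin (n + 1)} {k : Fin n}
    {b c : Bool} (h : Full (restr R i b) k c) (h' : Full (restr R i (!b)) k (!c)) :
    Full R (i.succAbove k) (b ^^ c) := by
  intro w hw
  obtain ⟨w', hw'⟩ := exists_ins i w
  generalize w i = a at hw'
  subst hw'
  rw [cls_ins_succAbove] at hw
  rw [nbr_ins_succAbove]
  rcases eq_or_ne a b with rfl | hab
  · exact h w' (by simpa using hw)
  · rw [Bool.eq_not_of_ne hab] at hw ⊢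
    refine h' w' ?_
    revert hw; cases cls k w' <;> cases b <;> cases c <;> simp

theorem twoPaths_step (hn : 5 ≤ n) {R : Vert (n + 1) → Vert (n + 1) → Prop}
    (hR : IsMatchingRel R) {i : Fin (n + 1)} (hi : ∀ w, ¬ R w (nbr w i))
    (ih : ∀ b u v, Admissible (restr R i b) u v → TwoPaths (restr R i b) u v)
    {u v : Vert (n + 1)} (h : Admissible R u v) : TwoPaths R u v := by
  have hRr := fun b => hR.restr i b
  obtain ⟨b, hb⟩ : ∃ b, b = u i := ⟨_, rfl⟩
  obtain ⟨u, hu⟩ := exists_ins i u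
  rw [← hb] at hu
  subst hu
  obtain ⟨v', hv⟩ := exists_ins i v
  by_cases hvb : v i = b
  · -- Both ends lie in the same subcube.
    rw [hvb] at hv
    subst hv
    rename' v' => v
    have hpar : par v = !par u := by
      have := h.par_eq
      rw [par_ins, par_ins] at this
      revert this; cases par u <;> cases par v <;> cases b <;> simp
    have hne : u ≠ v := by rintro rfl; simp at hpar
    by_cases h1 : Blocked1 (restr R i b) u v
    · obtain ⟨k, hk, hfull⟩ := h1
      have hvk : v ≠ nbr u k := by
        rintro rfl
        exact h.not_rel (hfull u rfl)
      have hk' : ¬ Full (restr R i (!b)) k (!cls k u) := fun hf =>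
        h.not_blocked1 ⟨i.succAbove k, by simp [hk], by
          rw [cls_ins_succAbove]; exact full_of_restr hfull hf⟩
      obtain ⟨m, rfl⟩ : ∃ m, n = m + 2 := ⟨n - 2, by omega⟩
      obtain ⟨c, d, p, q, hpq, hcd⟩ := exists_isCover_of_full (by omega) (hRr b) (hRr (!b)) hfull hk
        hpar hvk hk'
      exact TwoPaths.detour hR hi hpq (ih _ _ _ hcd)
    by_cases h2 : Blocked2 (restr R i b) u v
    · obtain ⟨k, j, hjk, rfl, halmost, huj, hvj⟩ := h2
      have hk' : ¬ Full (restr R i (!b)) k (!cls k u) := by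
        intro hf
        refine h.not_blocked2 ⟨i.succAbove k, i.succAbove j,
          fun e => hjk (Fin.succAbove_right_injective e), by simp, fun w hw hwu hwv => ?_, ?_, ?_⟩
        · obtain ⟨w', hw'⟩ := exists_ins i w
          generalize w i = a at hw'
          subst hw'
          rw [cls_ins_succAbove, cls_ins_succAbove] at hw
          rw [nbr_ins_succAbove]
          rcases eq_or_ne a b with rfl | hab
          · refine halmost w' (by simpa using hw) ?_ ?_
            · rintro rfl; exact hwu rfl
            · rintro rfl; exact hwv rfl
          · rw [Bool.eq_not_of_ne hab] at hw ⊢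
            refine hf w' ?_
            revert hw; cases cls k w' <;> cases b <;> cases cls k u <;> simp
        · rw [nbr_ins_succAbove]; exact huj
        · rw [nbr_ins_succAbove]; exact hvj
      obtain ⟨m, rfl⟩ : ∃ m, n = m + 1 := ⟨n - 1, by omega⟩
      obtain ⟨c, d, p, q, hpq, hcd⟩ := exists_isCover_of_blocked2 (by omega) (hRr b) (hRr (!b))
        hjk rfl halmost huj hvj hk'
      exact TwoPaths.detour hR hi hpq (ih _ _ _ hcd)
    · obtain ⟨c, d, e, A, B, hAB, hcd, hadm⟩ := exists_admissible_edge (hRr b) (hRr (!b)) hn hne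
        (ih b u v ⟨hpar, h1, h2, h.not_rel⟩)
      exact TwoPaths.detour hR hi (isCover_of_isHam (hRr b) hAB hcd) (ih _ _ _ hadm)
  · -- The ends lie in different subcubes.
    rw [Bool.eq_not_of_ne hvb] at hv
    subst hv
    rename' v' => v
    have hpar : par u = par v := by
      have := h.par_eq
      rw [par_ins, par_ins] at this
      revert this; cases par u <;> cases par v <;> cases b <;> simp
    obtain ⟨x, hx, hx'⟩ := exists_admissible (hRr b) (hRr (!b)) hn hpar (by
      intro k hk hk'
      by_contra hne
      have hvk : cls k v = !cls k u := Bool.eq_not_of_ne (Ne.symm hne)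
      rw [hvk] at hk'
      refine h.not_blocked1 ⟨i.succAbove k, by simp [hvk], ?_⟩
      rw [cls_ins_succAbove]
      exact full_of_restr hk hk')
    exact TwoPaths.join hR hi (ih _ _ _ hx) (ih _ _ _ hx')

/-- The matching with adjacency relation `R`, as a subgraph without isolated vertices. -/
def subgraphOfRel {R : Vert n → Vert n → Prop} (hR : IsMatchingRel R) : (graph n).Subgraph where
  verts := {u | ∃ v, R u v}
  Adj := R
  adj_sub h := hR.adj h
  edge_vert h := ⟨_, h⟩
  symm := ⟨fun _ _ h => hR.symm h⟩

theorem IsExtendingHamiltonPath.isHam {M : (graph n).Subgraph} {u v : Vert n}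
    {p : (graph n).Walk u v} (hp : IsExtendingHamiltonPath M p) : IsHam M.Adj p :=
  ⟨hp.1.isPath.support_nodup, hp.1.mem_support, fun h => hp.2 _ h⟩

theorem IsHam.isExtendingHamiltonPath {M : (graph n).Subgraph} {u v : Vert n}
    {p : (graph n).Walk u v} (hp : IsHam M.Adj p) : IsExtendingHamiltonPath M p := by
  refine ⟨(((SimpleGraph.Walk.isPath_def _).2 hp.nodup).isHamiltonian_iff).2 hp.mem, ?_⟩
  intro e he
  induction e with
  | _ a b => exact hp.rel he

theorem twoPaths_of_admissible {d : ℕ} (hd : 5 ≤ d) (hconj : TwoHamiltonPaths d) (hdn : d ≤ n)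
    {R : Vert n → Vert n → Prop} (hR : IsMatchingRel R) (D : Finset (Fin n)) (hD : D.card ≤ d)
    (hRD : ∀ w i, R w (nbr w i) → i ∈ D) {u v : Vert n} (h : Admissible R u v) :
    TwoPaths R u v := by
  induction n, hdn using Nat.le_induction with
  | base =>
    have hM : (subgraphOfRel hR).IsMatching :=
      fun x hx => ⟨hx.choose, hx.choose_spec, fun y hy => hR.unique hy hx.choose_spec⟩
    obtain ⟨p, q, hpq, hp, hq⟩ := hconj u v (subgraphOfRel hR) (oppositeParity_iff.2 h.par_eq) hM
      (fun h1 => h.not_blocked1 (C1_iff.1 h1)) (fun h2 => h.not_blocked2 (C2_iff.1 h2)) h.not_rel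
    exact ⟨p, q, hpq, hp.isHam, hq.isHam⟩
  | succ n hdn ih =>
    obtain ⟨i, hi⟩ := exists_notMem_of_card_lt (s := D) (by omega)
    refine twoPaths_step (by omega) hR (fun w hw => hi (hRD w i hw)) (fun b u v hb => ?_) h
    refine ih (hR.restr i b) (D.preimage i.succAbove Fin.succAbove_right_injective.injOn)
      ((Finset.card_le_card_of_injOn i.succAbove (fun j hj => by simpa using hj)
        Fin.succAbove_right_injective.injOn).trans hD) (fun w j hj => ?_) hb
    rw [Finset.mem_preimage]
    refine hRD (ins i b w) _ ?_
    rw [nbr_ins_succAbove]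
    exact hj

end QCube

theorem theorem1p8 (n d : ℕ) (hd : 5 ≤ d) (hdn : d ≤ n)
    (u v : QCube.Vert n) (huv : QCube.OppositeParity u v)
    (M : (QCube.graph n).Subgraph) (hM : M.IsMatching)
    (hdir : (QCube.directions M).ncard ≤ d)
    (hconj : QCube.TwoHamiltonPaths d) :
    (∃ p : (QCube.graph n).Walk u v, QCube.IsExtendingHamiltonPath M p) ↔
      (¬ QCube.C1 M u v ∧ ¬ QCube.C2 M u v ∧ ¬ QCube.C3 M u v) := by
  rw [QCube.C1_iff, QCube.C2_iff]
  constructor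
  · rintro ⟨p, hp⟩
    obtain ⟨pos, pr, h⟩ := QCube.exists_isNumbering hp
    exact ⟨h.not_blocked1 (by omega), h.not_blocked2 (by omega), h.not_rel (by omega)⟩
  · rintro ⟨h1, h2, h3⟩
    classical
    obtain ⟨p, -, -, hp, -⟩ := QCube.twoPaths_of_admissible hd hconj hdn
      (QCube.isMatchingRel_of_isMatching hM) (QCube.directions M).toFinite.toFinset
      (by rwa [← Set.ncard_eq_toFinset_card]) (fun w i h => by
        rw [Set.Finite.mem_toFinset]
        exact ⟨s(w, QCube.nbr w i), h, w, rfl⟩)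
      ⟨QCube.oppositeParity_iff.1 huv, h1, h2, h3⟩
    exact ⟨p, hp.isExtendingHamiltonPath⟩
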